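/- For $\alpha,\beta\in\mathbb{R}$ let $\mathscr{JS}_{\alpha,\beta}$ denote the class of entire functions $\tilde f$ for which there is an angle $0<\theta<\pi/2$ such that (I) $\tilde f(z)=O\bigl(|z|^{\alpha}(\log_+|z|)^{\beta}\bigr)$ uniformly for $|z|\ge 1$, $|\arg z|\le\theta$, where $\log_+x:=\log(1+x)$; and (O) for some $\varepsilon>0$, $e^{z}\tilde f(z)=O\bigl(e^{(1-\varepsilon)|z|}\bigr)$ uniformly for $|z|\ge1$, $\theta\le|\arg z|\le\pi$. Every entire function can be written uniquely as a Poisson generating function $\tilde f(z)=e^{-z}\sum_{n\ge0}\frac{a_n}{n!}z^n$. For $\tilde f(z)=e^{-z}\sum_{n\ge0}\frac{a_n}{n!}z^n$ and $\tilde g(z)=e^{-z}\sum_{n\ge0}\frac{b_n}{n!}z^n$ their Hadamard product is $(\tilde f\odot\tilde g)(z):=e^{-z}\sum_{n\ge0}\frac{a_nb_n}{n!}z^n$. **Proposition.** If $\tilde f\in\mathscr{JS}_{\alpha_1,\beta_1}$ and $\tilde g\in\mathscr{JS}_{\alpha_2,\beta_2}$, then the series defining $\tilde h:=\tilde f\odot\tilde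 g$ converges for every $z\in\mathbb{C}$, and $\tilde h\in\mathscr{JS}_{\alpha_1+\alpha_2,\beta_1+\beta_2}$. More precisely, there is an angle $0<\theta<\pi/2$ such that $$\tilde h(z)=\tilde f(z)\tilde g(z)+z\tilde f'(z)\tilde g'(z)+O\left(|z|^{\alpha_1+\alpha_2-2}(\log_+|z|)^{\beta_1+\beta_2}\right),$$ uniformly as $|z|\to\infty$ with $|\arg z|\le\theta$. -/

import Mathlib

open Filter Asymptotics Bornology
open scoped Nat

/-- `log₊ x := log (1 + x)`. -/
noncomputable def logPlus (x : ℝ) : ℝ := Real.log (1 + x)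

/-- The conditions of JS-admissibility with parameters `α, β` for the given sector angle `θ`:
`f` is entire; (I) polynomial growth inside the sector `|arg z| ≤ θ`; (O) the exponential bound
for `e^z f(z)` outside it. Both estimates are uniform over the `z` in question with `|z| ≥ 1`. -/
structure IsJSAdmissibleIn (θ α β : ℝ) (f : ℂ → ℂ) : Prop where
  entire : Differentiable ℂ f
  growth : f =O[𝓟 {z : ℂ | 1 ≤ ‖z‖ ∧ |z.arg| ≤ θ}] fun z : ℂ => ‖z‖ ^ α * logPlus ‖z‖ ^ β
  expBound : ∃ ε : ℝ, 0 < ε ∧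
    (fun z : ℂ => Complex.exp z * f z) =O[𝓟 {z : ℂ | 1 ≤ ‖z‖ ∧ θ ≤ |z.arg|}]
      fun z : ℂ => Real.exp ((1 - ε) * ‖z‖)

/-- `f` belongs to the class of JS-admissible functions with parameters `α, β`. -/
def IsJSAdmissible (α β : ℝ) (f : ℂ → ℂ) : Prop :=
  ∃ θ : ℝ, 0 < θ ∧ θ < Real.pi / 2 ∧ IsJSAdmissibleIn θ α β f

/-- The Poisson generating function `e^{-z} ∑ aₙ zⁿ / n!` of the sequence `a`. -/
noncomputable def poissonGF (a : ℕ → ℂ) (z : ℂ) : ℂ :=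
  Complex.exp (-z) * ∑' n : ℕ, a n / (n ! : ℂ) * z ^ n

/-- The sequence `a` of which an entire function `f` is the Poisson generating function:
`aₙ` is `n!` times the coefficient of `zⁿ` in the power series of `e^z f(z)`. -/
noncomputable def poissonCoeff (f : ℂ → ℂ) (n : ℕ) : ℂ :=
  iteratedDeriv n (fun z : ℂ => Complex.exp z * f z) 0

/-- Every entire function is the sum of its Poisson generating series. -/
theorem hasSum_poissonCoeff {f : ℂ → ℂ} (hf : Differentiable ℂ f) (z : ℂ) :
    HasSum (fun n : ℕ => poissonCoeff f n / (n ! : ℂ) * z ^ n) (Complex.exp z * f z) := by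
  have hd : Differentiable ℂ fun z : ℂ => Complex.exp z * f z := Complex.differentiable_exp.mul hf
  have h := Complex.hasSum_taylorSeries_of_entire hd 0 z
  have e : (fun n : ℕ => poissonCoeff f n / (n ! : ℂ) * z ^ n) = fun n : ℕ =>
      (n ! : ℂ)⁻¹ • (z - 0) ^ n • iteratedDeriv n (fun z : ℂ => Complex.exp z * f z) 0 := by
    funext n
    simp only [poissonCoeff, sub_zero, smul_eq_mul]
    ring
  rw [e]
  exact h

/-- An entire function is the Poisson generating function of its sequence. -/
theorem poissonGF_poissonCoeff {f : ℂ → ℂ} (hf : Differentiable ℂ f) :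
    poissonGF (poissonCoeff f) = f := by
  funext z
  rw [poissonGF, (hasSum_poissonCoeff hf z).tsum_eq, ← mul_assoc, ← Complex.exp_add]
  simp

/-- The sequence is determined by the function: if `e^{-z} ∑ aₙ zⁿ / n!` converges to `f z`
for all `z`, then `a` is the sequence of `f`. -/
theorem poissonCoeff_eq {f : ℂ → ℂ} {a : ℕ → ℂ}
    (h : ∀ z : ℂ, HasSum (fun n : ℕ => a n / (n ! : ℂ) * z ^ n) (Complex.exp z * f z)) :
    poissonCoeff f = a := by
  have h1 : HasFPowerSeriesAt (fun z : ℂ => Complex.exp z * f z)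
      (FormalMultilinearSeries.ofScalars ℂ fun n => a n / (n ! : ℂ)) 0 := by
    rw [hasFPowerSeriesAt_iff]
    refine Eventually.of_forall fun z => ?_
    simpa [mul_comm] using h z
  funext n
  have h2 := congrArg (fun p : FormalMultilinearSeries ℂ ℂ ℂ => p.coeff n)
    (h1.eq_formalMultilinearSeries h1.analyticAt.hasFPowerSeriesAt)
  have hn : (n ! : ℂ) ≠ 0 := by exact_mod_cast n.factorial_ne_zero
  simp at h2
  rw [div_left_inj' hn] at h2
  exact h2.symm

/-- The Hadamard product of the Poisson generating functions `f` and `g`: the Poisson generating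
function of the termwise product of their sequences. -/
noncomputable def poissonHadamard (f g : ℂ → ℂ) : ℂ → ℂ :=
  poissonGF fun n => poissonCoeff f n * poissonCoeff g n

/-! The engine is the identity `f ⊙ g = ∑ zᵏ/k! f⁽ᵏ⁾ g⁽ᵏ⁾`. Writing `H(f, g)` for the right side,
termwise differentiation gives `(e^z H(f, g))' = e^z H(f + f', g + g')`, while replacing `f` by `f +
f'` shifts its Poisson sequence by one; induction then matches all coefficients
(`IsExpType.poissonHadamard_eq`).

In a narrow cone the terms `k = 0, 1` are the main terms. For `k ≥ 2` Cauchy's estimate is used with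
two radii. If `k` is small against `‖z‖`, radius `δ‖z‖` stays in the cone of polynomial growth and
the terms decay geometrically from order `‖z‖⁻²`. Otherwise radius `√(k‖z‖)` is nearly optimal, and
condition (O) gains a factor `e^(-εk/8)` for each function (`exponent_le_of_norm_sub_eq`), so these
terms are exponentially small in `‖z‖`.

Outside the cone, put `F = e^z f`, `G = e^z g`. Then `e^z (f ⊙ g)(z) = ∫₀^∞ e^(-t) K(zt) dt`, where
`K(x²)` is the mean of `F(x e^(-iθ)) G(x e^(iθ))` over `θ`. The two arguments have product `x²`;
when `x²` is outside the cone they cannot both lie in a cone of half the angle, so one factor is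
exponentially smaller than `e^|x|`. The inequality `2√(‖z‖t) ≤ ‖z‖ + t` carries this gain through
the integral. -/

/-! ### The growth scale and its comparison with exponentials -/

section Weight

/-- The growth scale `r ^ a * log₊ r ^ b`. -/
noncomputable def growthScale (a b r : ℝ) : ℝ := r ^ a * logPlus r ^ b

theorem logPlus_pos {r : ℝ} (hr : 0 < r) : 0 < logPlus r := Real.log_pos (by linarith)

theorem growthScale_pos {a b r : ℝ} (hr : 0 < r) : 0 < growthScale a b r :=
  mul_pos (Real.rpow_pos_of_pos hr a) (Real.rpow_pos_of_pos (logPlus_pos hr) b)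

theorem growthScale_mul {a b a' b' r : ℝ} (hr : 0 < r) :
    growthScale a b r * growthScale a' b' r = growthScale (a + a') (b + b') r := by
  rw [growthScale, growthScale, growthScale, Real.rpow_add hr, Real.rpow_add (logPlus_pos hr)]
  ring

theorem exists_rpow_le_exp (s : ℝ) {η : ℝ} (hη : 0 < η) :
    ∃ C : ℝ, 0 < C ∧ ∀ r : ℝ, 1 / 2 ≤ r → r ^ s ≤ C * Real.exp (η * r) := by
  obtain ⟨n, hn⟩ := exists_nat_ge s
  refine ⟨(1 / 2) ^ s * (2 ^ n * (n ! : ℝ) / η ^ n), by positivity, fun r hr => ?_⟩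
  have hr0 : 0 < r := by linarith
  -- Since `2r ≥ 1`, the exponent may be rounded up to a natural number, whatever the sign of `s`.
  have h1 : r ^ s = (1 / 2) ^ s * (2 * r) ^ s := by
    rw [← Real.mul_rpow (by norm_num) (by positivity)]; congr 1; ring
  have h2 : (2 * r) ^ s ≤ (2 * r) ^ n := by
    rw [← Real.rpow_natCast]
    exact Real.rpow_le_rpow_of_exponent_le (by linarith) hn
  have h3 := Real.pow_div_factorial_le_exp (η * r) (by positivity) n
  rw [h1, mul_assoc]
  refine mul_le_mul_of_nonneg_left (h2.trans ?_) (by positivity)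
  have hf : (0 : ℝ) < n ! := by exact_mod_cast n.factorial_pos
  calc (2 * r) ^ n = (2 ^ n * (n ! : ℝ) / η ^ n) * ((η * r) ^ n / n !) := by
        rw [mul_pow, mul_pow]; field_simp
    _ ≤ _ := mul_le_mul_of_nonneg_left h3 (by positivity)

theorem exists_growthScale_le_exp (a b : ℝ) {η : ℝ} (hη : 0 < η) :
    ∃ C : ℝ, 0 < C ∧ ∀ r : ℝ, 1 / 2 ≤ r → growthScale a b r ≤ C * Real.exp (η * r) := by
  rcases le_total 0 b with hb | hb
  · obtain ⟨C, hC, h⟩ := exists_rpow_le_exp (a + b) hη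
    refine ⟨C, hC, fun r hr => le_trans ?_ (h r hr)⟩
    have hr0 : 0 < r := by linarith
    rw [growthScale, Real.rpow_add hr0]
    refine mul_le_mul_of_nonneg_left ?_ (by positivity)
    refine Real.rpow_le_rpow (logPlus_pos hr0).le ?_ hb
    have := Real.log_le_sub_one_of_pos (show 0 < 1 + r by linarith)
    rw [logPlus]; linarith
  · obtain ⟨C, hC, h⟩ := exists_rpow_le_exp a hη
    have hl : 0 < logPlus (1 / 2) := logPlus_pos (by norm_num)
    refine ⟨C * logPlus (1 / 2) ^ b, mul_pos hC (Real.rpow_pos_of_pos hl b), fun r hr => ?_⟩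
    have h2 : logPlus r ^ b ≤ logPlus (1 / 2) ^ b :=
      Real.rpow_le_rpow_of_nonpos hl (Real.log_le_log (by norm_num) (by linarith)) hb
    have hr0 : 0 < r := by linarith
    calc growthScale a b r ≤ (C * Real.exp (η * r)) * logPlus (1 / 2) ^ b :=
          mul_le_mul (h r hr) h2 (Real.rpow_pos_of_pos (logPlus_pos hr0) b).le (by positivity)
      _ = _ := by ring

theorem rpow_le_two_rpow_abs_mul {x y : ℝ} (a : ℝ) (hx : 0 < x) (h1 : x / 2 ≤ y) (h2 : y ≤ 2 * x) :
    y ^ a ≤ 2 ^ |a| * x ^ a := by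
  have hy : 0 < y := by linarith
  rcases le_total 0 a with ha | ha
  · rw [abs_of_nonneg ha, ← Real.mul_rpow (by norm_num) hx.le]
    exact Real.rpow_le_rpow hy.le h2 ha
  · rw [abs_of_nonpos ha, Real.rpow_neg (by norm_num), ← Real.inv_rpow (by norm_num),
      ← Real.mul_rpow (by norm_num) hx.le]
    exact Real.rpow_le_rpow_of_nonpos (by positivity) (by linarith) ha

/-- Needed on Cauchy circles of radius at most half the modulus of the centre. The logarithms
compare because `(1 + s)² ≥ 1 + 2s ≥ 1 + r`, and likewise with `r` and `s` exchanged. -/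
theorem growthScale_le_mul {a b r s : ℝ} (hr : 0 < r) (h1 : r / 2 ≤ s) (h2 : s ≤ 2 * r) :
    growthScale a b s ≤ 2 ^ |a| * 2 ^ |b| * growthScale a b r := by
  have hs : 0 < s := by linarith
  have l1 : logPlus r / 2 ≤ logPlus s := by
    have : logPlus r ≤ 2 * logPlus s := by
      rw [logPlus, logPlus, ← Real.log_rpow (by linarith)]
      refine Real.log_le_log (by linarith) ?_
      norm_num
      nlinarith
    linarith
  have l2 : logPlus s ≤ 2 * logPlus r := by
    rw [logPlus, logPlus, ← Real.log_rpow (by linarith)]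
    refine Real.log_le_log (by linarith) ?_
    norm_num
    nlinarith
  calc growthScale a b s ≤ (2 ^ |a| * r ^ a) * (2 ^ |b| * logPlus r ^ b) :=
        mul_le_mul (rpow_le_two_rpow_abs_mul a hr h1 h2)
          (rpow_le_two_rpow_abs_mul b (logPlus_pos hr) l1 l2)
          (Real.rpow_pos_of_pos (logPlus_pos hs) b).le (by positivity)
    _ = _ := by rw [growthScale]; ring

end Weight

/-! ### Admissibility as explicit estimates on cones -/

section Cone

/-- Cosine decreases on `[0, π]`. This trades angles for inequalities between `z.re` and `‖z‖`, in
which all later geometry is done. -/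
theorem abs_arg_le_iff {z : ℂ} (hz : z ≠ 0) {θ : ℝ} (h0 : 0 ≤ θ) (h1 : θ ≤ Real.pi) :
    |z.arg| ≤ θ ↔ Real.cos θ * ‖z‖ ≤ z.re := by
  have hn : 0 < ‖z‖ := norm_pos_iff.mpr hz
  have h2 : z.re = Real.cos |z.arg| * ‖z‖ := by
    rw [Real.cos_abs, Complex.cos_arg hz]; field_simp
  rw [h2, mul_le_mul_iff_left₀ hn]
  exact (Real.strictAntiOn_cos.le_iff_ge ⟨h0, h1⟩
    ⟨abs_nonneg _, Complex.abs_arg_le_pi z⟩).symm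

theorem le_abs_arg_iff {z : ℂ} (hz : z ≠ 0) {θ : ℝ} (h0 : 0 ≤ θ) (h1 : θ ≤ Real.pi) :
    θ ≤ |z.arg| ↔ z.re ≤ Real.cos θ * ‖z‖ := by
  have hn : 0 < ‖z‖ := norm_pos_iff.mpr hz
  have h2 : z.re = Real.cos |z.arg| * ‖z‖ := by
    rw [Real.cos_abs, Complex.cos_arg hz]; field_simp
  rw [h2, mul_le_mul_iff_left₀ hn]
  exact (Real.strictAntiOn_cos.le_iff_ge ⟨abs_nonneg _, Complex.abs_arg_le_pi z⟩
    ⟨h0, h1⟩).symm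

/-- Growth of an entire function in the cone `c‖z‖ ≤ re z` and outside it, with constants. -/
structure ConeBound (c ε α β C : ℝ) (f : ℂ → ℂ) : Prop where
  entire : Differentiable ℂ f
  growth : ∀ z : ℂ, 1 / 2 ≤ ‖z‖ → c * ‖z‖ ≤ z.re → ‖f z‖ ≤ C * growthScale α β ‖z‖
  expBound : ∀ z : ℂ, z.re ≤ c * ‖z‖ → ‖Complex.exp z * f z‖ ≤ C * Real.exp ((1 - ε) * ‖z‖)

theorem ConeBound.mono {c ε α β C ε' C' : ℝ} {f : ℂ → ℂ} (h : ConeBound c ε α β C f)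
    (hε : ε' ≤ ε) (hC : C ≤ C') (hC0 : 0 ≤ C) : ConeBound c ε' α β C' f where
  entire := h.entire
  growth z h1 h2 := (h.growth z h1 h2).trans
    (mul_le_mul_of_nonneg_right hC (growthScale_pos (by linarith)).le)
  expBound z h1 := (h.expBound z h1).trans <| by
    gcongr
    exact hC0.trans hC

theorem exists_norm_le_of_norm_le {f : ℂ → ℂ} (hf : Continuous f) (R : ℝ) :
    ∃ C : ℝ, 0 < C ∧ ∀ z : ℂ, ‖z‖ ≤ R → ‖f z‖ ≤ C := by
  obtain ⟨C, hC⟩ := (isCompact_closedBall (0 : ℂ) R).exists_bound_of_continuousOn hf.continuousOn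
  exact ⟨max C 1, by positivity, fun z hz => (hC z (by simpa using hz)).trans (le_max_left _ _)⟩

/-- The reciprocal of a growth scale is the scale with negated exponents, so an upper bound for one
is a lower bound for the other. -/
theorem exists_le_growthScale (a b : ℝ) :
    ∃ m : ℝ, 0 < m ∧ ∀ r : ℝ, 1 / 2 ≤ r → r ≤ 1 → m ≤ growthScale a b r := by
  obtain ⟨C, hC, h⟩ := exists_growthScale_le_exp (-a) (-b) one_pos
  refine ⟨(C * Real.exp 1)⁻¹, by positivity, fun r h1 h2 => ?_⟩
  have hr : 0 < r := by linarith
  have h3 : growthScale a b r * growthScale (-a) (-b) r = 1 := by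
    rw [growthScale_mul hr]; simp [growthScale]
  rw [eq_inv_of_mul_eq_one_left h3]
  refine inv_anti₀ (growthScale_pos hr) ((h r h1).trans ?_)
  gcongr
  linarith

/-- Compactness of the unit disc extends the estimates below `‖z‖ = 1`. Capping `ε` at 1 keeps the
exponential at least 1 there. -/
theorem IsJSAdmissibleIn.exists_coneBound {θ α β : ℝ} {f : ℂ → ℂ} (h : IsJSAdmissibleIn θ α β f)
    (h0 : 0 < θ) (h1 : θ < Real.pi / 2) :
    ∃ ε C : ℝ, 0 < ε ∧ ε ≤ 1 ∧ 0 < C ∧ ConeBound (Real.cos θ) ε α β C f := by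
  have hπ : θ ≤ Real.pi := by linarith [Real.pi_pos]
  obtain ⟨C₁, hC₁⟩ := isBigO_principal.mp h.growth
  obtain ⟨ε, hε, hO⟩ := h.expBound
  obtain ⟨C₂, hC₂⟩ := isBigO_principal.mp hO
  obtain ⟨C₃, hC₃, h₃⟩ := exists_norm_le_of_norm_le h.entire.continuous 1
  obtain ⟨C₄, hC₄, h₄⟩ := exists_norm_le_of_norm_le
    (Complex.continuous_exp.mul h.entire.continuous) 1
  obtain ⟨m, hm, hm'⟩ := exists_le_growthScale α β
  have hε1 : 0 ≤ 1 - min ε 1 := by linarith [min_le_right ε 1]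
  refine ⟨min ε 1, max (max C₁ C₂) (max (C₃ / m) C₄), by positivity, min_le_right _ _,
    lt_max_of_lt_right (lt_max_of_lt_right hC₄), h.entire, fun z hz hz' => ?_, fun z hz => ?_⟩
  · have hz0 : 0 < ‖z‖ := by linarith
    have hp := growthScale_pos (a := α) (b := β) hz0
    rcases le_total 1 ‖z‖ with hz1 | hz1
    · have h5 := hC₁ z ⟨hz1, (abs_arg_le_iff (norm_pos_iff.mp hz0) h0.le hπ).mpr hz'⟩
      change ‖f z‖ ≤ C₁ * ‖growthScale α β ‖z‖‖ at h5
      rw [Real.norm_of_nonneg hp.le] at h5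
      exact h5.trans (mul_le_mul_of_nonneg_right
        ((le_max_left _ _).trans (le_max_left _ _)) hp.le)
    · have h5 := hm' _ hz hz1
      calc ‖f z‖ ≤ C₃ := h₃ z hz1
        _ = C₃ / m * m := by field_simp
        _ ≤ _ := mul_le_mul ((le_max_left _ _).trans (le_max_right _ _)) h5 hm.le
          (lt_max_of_lt_right (lt_max_of_lt_right hC₄)).le
  · rcases le_total 1 ‖z‖ with hz1 | hz1
    · have hz0 : 0 < ‖z‖ := by linarith
      have h5 := hC₂ z ⟨hz1, (le_abs_arg_iff (norm_pos_iff.mp hz0) h0.le hπ).mpr hz⟩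
      rw [Real.norm_of_nonneg (Real.exp_pos _).le] at h5
      refine h5.trans (mul_le_mul ((le_max_right _ _).trans (le_max_left _ _)) ?_
        (Real.exp_pos _).le (lt_max_of_lt_right (lt_max_of_lt_right hC₄)).le)
      gcongr
      exact min_le_left _ _
    · have h5 : C₄ ≤ max (max C₁ C₂) (max (C₃ / m) C₄) :=
        (le_max_right _ _).trans (le_max_right _ _)
      refine ((h₄ z hz1).trans h5).trans ?_
      refine le_mul_of_one_le_right (lt_max_of_lt_right (lt_max_of_lt_right hC₄)).le ?_
      exact Real.one_le_exp (by positivity)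

/-- In the cone the function grows slower than any exponential. -/
theorem ConeBound.exists_norm_le_exp {c ε α β C : ℝ} {f : ℂ → ℂ} (h : ConeBound c ε α β C f)
    (hC : 0 < C) {η : ℝ} (hη : 0 < η) :
    ∃ A : ℝ, 0 < A ∧ ∀ z : ℂ, c * ‖z‖ ≤ z.re → ‖f z‖ ≤ A * Real.exp (η * ‖z‖) := by
  obtain ⟨B, hB, hB'⟩ := exists_growthScale_le_exp α β hη
  obtain ⟨D, hD, hD'⟩ := exists_norm_le_of_norm_le h.entire.continuous (1 / 2)
  refine ⟨C * B + D, by positivity, fun z hz => ?_⟩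
  have he : 1 ≤ Real.exp (η * ‖z‖) := Real.one_le_exp (by positivity)
  rcases le_total (1 / 2) ‖z‖ with h1 | h1
  · have := mul_le_mul_of_nonneg_left (hB' _ h1) hC.le
    have := h.growth z h1 hz
    nlinarith
  · have := hD' z h1
    nlinarith [mul_pos hC hB]

/-- The cone may be shrunk, at the cost of a worse exponential bound outside it. -/
theorem ConeBound.shrink {c ε α β C c' : ℝ} {f : ℂ → ℂ} (h : ConeBound c ε α β C f)
    (hC : 0 < C) (hε : 0 < ε) (hε1 : ε ≤ 1) (hc : c ≤ c') (hc' : c' < 1) :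
    ∃ ε' C' : ℝ, 0 < ε' ∧ ε' ≤ 1 ∧ 0 < C' ∧ ConeBound c' ε' α β C' f := by
  -- Between the two cones `|e^z| ≤ e^(c'‖z‖)`; half of the gap `1 - c'` pays for the growth of `f`,
  -- the other half is left as the new `ε'`.
  obtain ⟨A, hA, hA'⟩ := h.exists_norm_le_exp hC (η := (1 - c') / 2) (by linarith)
  refine ⟨min ε ((1 - c') / 2), max C A, lt_min hε (by linarith), (min_le_left _ _).trans hε1,
    lt_max_of_lt_left hC, h.entire, fun z h1 h2 => ?_, fun z hz => ?_⟩
  · refine (h.growth z h1 ((mul_le_mul_of_nonneg_right hc (norm_nonneg z)).trans h2)).trans ?_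
    exact mul_le_mul_of_nonneg_right (le_max_left _ _) (growthScale_pos (by linarith)).le
  · rcases le_total z.re (c * ‖z‖) with h1 | h1
    · refine (h.expBound z h1).trans ?_
      gcongr
      · exact le_max_left _ _
      · exact min_le_left _ _
    · rw [norm_mul, Complex.norm_exp]
      calc Real.exp z.re * ‖f z‖
          ≤ Real.exp (c' * ‖z‖) * (A * Real.exp ((1 - c') / 2 * ‖z‖)) := by
            gcongr
            exact hA' z h1
        _ = A * Real.exp ((1 - (1 - c') / 2) * ‖z‖) := by
            rw [mul_left_comm, ← Real.exp_add]; ring_nf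
        _ ≤ _ := by
            gcongr
            · exact le_max_right _ _
            · exact min_le_right _ _

/-- Conversely, estimates in and outside a cone give JS-admissibility. -/
theorem isJSAdmissible_of_cone {c ε α β C : ℝ} {f : ℂ → ℂ} (hf : Differentiable ℂ f)
    (hc0 : 0 < c) (hc1 : c < 1) (hε : 0 < ε)
    (hI : ∀ z : ℂ, 1 ≤ ‖z‖ → c * ‖z‖ ≤ z.re → ‖f z‖ ≤ C * growthScale α β ‖z‖)
    (hO : ∀ z : ℂ, z.re ≤ c * ‖z‖ → ‖Complex.exp z * f z‖ ≤ C * Real.exp ((1 - ε) * ‖z‖)) :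
    IsJSAdmissible α β f := by
  have hp : 0 < Real.arccos c := Real.arccos_pos.mpr hc1
  have hp2 : Real.arccos c < Real.pi / 2 := Real.arccos_lt_pi_div_two.mpr hc0
  have hcos : Real.cos (Real.arccos c) = c := Real.cos_arccos (by linarith) hc1.le
  have hπ : Real.arccos c ≤ Real.pi := Real.arccos_le_pi c
  refine ⟨Real.arccos c, hp, hp2, hf, isBigO_principal.mpr ⟨C, ?_⟩,
    ε, hε, isBigO_principal.mpr ⟨C, ?_⟩⟩
  · rintro z ⟨h1, h2⟩
    have hz0 : 0 < ‖z‖ := by linarith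
    rw [abs_arg_le_iff (norm_pos_iff.mp hz0) hp.le hπ, hcos] at h2
    have := hI z h1 h2
    change _ ≤ C * ‖growthScale α β ‖z‖‖
    rwa [Real.norm_of_nonneg (growthScale_pos hz0).le]
  · rintro z ⟨h1, h2⟩
    have hz0 : 0 < ‖z‖ := by linarith
    rw [le_abs_arg_iff (norm_pos_iff.mp hz0) hp.le hπ, hcos] at h2
    rw [Real.norm_of_nonneg (Real.exp_pos _).le]
    exact hO z h2

end Cone

/-! ### The Hadamard product as a series in derivatives -/

section HadamardSeries

/-- Entire functions of exponential type. -/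
def IsExpType (f : ℂ → ℂ) : Prop :=
  Differentiable ℂ f ∧ ∃ C M : ℝ, 0 ≤ M ∧ ∀ z : ℂ, ‖f z‖ ≤ C * Real.exp (M * ‖z‖)

theorem norm_iteratedDeriv_le_of_sphere {f : ℂ → ℂ} (hf : Differentiable ℂ f) (k : ℕ) {z : ℂ}
    {R A : ℝ} (hR : 0 < R) (h : ∀ w : ℂ, ‖w - z‖ = R → ‖f w‖ ≤ A) :
    ‖iteratedDeriv k f z‖ ≤ (k ! : ℝ) * A / R ^ k :=
  Complex.norm_iteratedDeriv_le_of_forall_mem_sphere_norm_le k hR hf.diffContOnCl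
    fun w hw => h w (by simpa [dist_eq_norm] using hw)

/-- Cauchy's estimate on a circle of radius `k`, with `k! ≤ kᵏ`. Geometric growth in `k` is beaten
by the `1/k!` in `hadamardTerm`. -/
theorem IsExpType.exists_norm_iteratedDeriv_le {f : ℂ → ℂ} (hf : IsExpType f) :
    ∃ C M : ℝ, 0 ≤ C ∧ 0 ≤ M ∧ ∀ (k : ℕ) (z : ℂ),
      ‖iteratedDeriv k f z‖ ≤ C * Real.exp (M * ‖z‖) * Real.exp M ^ k := by
  obtain ⟨hd, C, M, hM, h⟩ := hf
  have hC : 0 ≤ C := by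
    have := (norm_nonneg _).trans (h 0)
    simpa using this
  refine ⟨C, M, hC, hM, fun k z => ?_⟩
  rcases Nat.eq_zero_or_pos k with rfl | hk
  · simpa using h z
  have hk' : (0 : ℝ) < k := by exact_mod_cast hk
  have h1 := norm_iteratedDeriv_le_of_sphere hd k (z := z) (R := k)
    (A := C * Real.exp (M * (‖z‖ + k))) hk' fun w hw => (h w).trans <| by
      gcongr
      have := norm_add_le z (w - z)
      rw [hw] at this
      simpa using this
  have h2 : (k ! : ℝ) ≤ (k : ℝ) ^ k := by exact_mod_cast Nat.factorial_le_pow k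
  refine h1.trans ?_
  rw [div_le_iff₀ (by positivity), ← Real.exp_nat_mul, mul_assoc C, ← Real.exp_add, mul_comm]
  have e : M * ‖z‖ + k * M = M * (‖z‖ + k) := by ring
  rw [e]
  gcongr

theorem IsExpType.deriv {f : ℂ → ℂ} (hf : IsExpType f) : IsExpType (deriv f) := by
  obtain ⟨C, M, -, hM, h⟩ := hf.exists_norm_iteratedDeriv_le
  refine ⟨hf.1.deriv, C * Real.exp M, M, hM, fun z => ?_⟩
  have := h 1 z
  rw [iteratedDeriv_one] at this
  refine this.trans (le_of_eq ?_)
  ring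

theorem IsExpType.add {f g : ℂ → ℂ} (hf : IsExpType f) (hg : IsExpType g) :
    IsExpType (f + g) := by
  obtain ⟨hf, C, M, hM, h⟩ := hf
  obtain ⟨hg, C', M', -, h'⟩ := hg
  have hC : 0 ≤ C := by simpa using (norm_nonneg _).trans (h 0)
  have hC' : 0 ≤ C' := by simpa using (norm_nonneg _).trans (h' 0)
  refine ⟨hf.add hg, C + C', max M M', le_max_of_le_left hM, fun z => ?_⟩
  rw [Pi.add_apply, add_mul]
  refine (norm_add_le _ _).trans (add_le_add ((h z).trans ?_) ((h' z).trans ?_))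
  · gcongr
    exact le_max_left _ _
  · gcongr
    exact le_max_right _ _

/-- The `k`-th term of the expansion of a Poisson Hadamard product. -/
noncomputable def hadamardTerm (f g : ℂ → ℂ) (k : ℕ) (z : ℂ) : ℂ :=
  z ^ k / (k ! : ℂ) * (iteratedDeriv k f z * iteratedDeriv k g z)

/-- The series `∑ zᵏ/k! f⁽ᵏ⁾(z) g⁽ᵏ⁾(z)`. -/
noncomputable def hadamardSeries (f g : ℂ → ℂ) (z : ℂ) : ℂ := ∑' k, hadamardTerm f g k z

theorem IsExpType.hadamardTerm_bound {f g : ℂ → ℂ} (hf : IsExpType f) (hg : IsExpType g)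
    (r : ℝ) : ∃ u : ℕ → ℝ, Summable u ∧
      ∀ (k : ℕ) (z : ℂ), z ∈ Metric.ball (0 : ℂ) r → ‖hadamardTerm f g k z‖ ≤ u k := by
  obtain ⟨C, M, hC, hM, h⟩ := hf.exists_norm_iteratedDeriv_le
  obtain ⟨C', M', hC', hM', h'⟩ := hg.exists_norm_iteratedDeriv_le
  refine ⟨fun k => (C * Real.exp (M * r) * (C' * Real.exp (M' * r))) *
    ((r * Real.exp M * Real.exp M') ^ k / (k ! : ℝ)),
    (Real.summable_pow_div_factorial _).mul_left _, fun k z hz => ?_⟩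
  have hz' : ‖z‖ ≤ r := by simpa using (mem_ball_zero_iff.mp hz).le
  have h1 : ‖iteratedDeriv k f z‖ ≤ C * Real.exp (M * r) * Real.exp M ^ k :=
    (h k z).trans (by gcongr)
  have h2 : ‖iteratedDeriv k g z‖ ≤ C' * Real.exp (M' * r) * Real.exp M' ^ k :=
    (h' k z).trans (by gcongr)
  rw [hadamardTerm, norm_mul, norm_mul, norm_div, norm_pow, Complex.norm_natCast]
  calc ‖z‖ ^ k / (k ! : ℝ) * (‖iteratedDeriv k f z‖ * ‖iteratedDeriv k g z‖)
      ≤ r ^ k / (k ! : ℝ) * ((C * Real.exp (M * r) * Real.exp M ^ k) *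
          (C' * Real.exp (M' * r) * Real.exp M' ^ k)) := by
        have hr : 0 ≤ r := (norm_nonneg z).trans hz'
        gcongr
    _ = _ := by simp only [mul_pow]; ring

theorem IsExpType.summable_hadamardTerm {f g : ℂ → ℂ} (hf : IsExpType f) (hg : IsExpType g)
    (z : ℂ) : Summable fun k => hadamardTerm f g k z := by
  obtain ⟨u, hu, h⟩ := hf.hadamardTerm_bound hg (‖z‖ + 1)
  exact Summable.of_norm_bounded hu fun k => h k z (by simp)

theorem differentiable_iteratedDeriv {f : ℂ → ℂ} (hf : Differentiable ℂ f) (k : ℕ) :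
    Differentiable ℂ (iteratedDeriv k f) :=
  (hf.contDiff (n := ⊤)).differentiable_iteratedDeriv k (WithTop.coe_lt_top _)

theorem differentiable_hadamardTerm {f g : ℂ → ℂ} (hf : Differentiable ℂ f)
    (hg : Differentiable ℂ g) (k : ℕ) : Differentiable ℂ (hadamardTerm f g k) := by
  have h1 := differentiable_iteratedDeriv hf k
  have h2 := differentiable_iteratedDeriv hg k
  unfold hadamardTerm
  fun_prop

theorem hasDerivAt_hadamardTerm {f g : ℂ → ℂ} (hf : Differentiable ℂ f)
    (hg : Differentiable ℂ g) (k : ℕ) (z : ℂ) :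
    HasDerivAt (hadamardTerm f g k) ((k : ℂ) * z ^ (k - 1) / (k ! : ℂ) *
      (iteratedDeriv k f z * iteratedDeriv k g z) + (hadamardTerm (deriv f) g k z +
      hadamardTerm f (deriv g) k z)) z := by
  have h1 : HasDerivAt (iteratedDeriv k f) (iteratedDeriv k (deriv f) z) z := by
    rw [← iteratedDeriv_succ', iteratedDeriv_succ]
    exact (differentiable_iteratedDeriv hf k z).hasDerivAt
  have h2 : HasDerivAt (iteratedDeriv k g) (iteratedDeriv k (deriv g) z) z := by
    rw [← iteratedDeriv_succ', iteratedDeriv_succ]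
    exact (differentiable_iteratedDeriv hg k z).hasDerivAt
  have h3 := ((hasDerivAt_pow k z).div_const (k ! : ℂ)).mul (h1.mul h2)
  refine h3.congr_deriv ?_
  simp only [hadamardTerm, Pi.mul_apply]
  ring

theorem IsExpType.hasDerivAt_hadamardSeries {f g : ℂ → ℂ} (hf : IsExpType f) (hg : IsExpType g)
    (z : ℂ) : HasDerivAt (hadamardSeries f g) (hadamardSeries (_root_.deriv f) (_root_.deriv g) z +
      (hadamardSeries (_root_.deriv f) g z + hadamardSeries f (_root_.deriv g) z)) z := by
  obtain ⟨u, hu, h⟩ := hf.hadamardTerm_bound hg (‖z‖ + 1)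
  have hz : z ∈ Metric.ball (0 : ℂ) (‖z‖ + 1) := by simp
  have hD : ∀ k, DifferentiableOn ℂ (hadamardTerm f g k) (Metric.ball 0 (‖z‖ + 1)) :=
    fun k => (differentiable_hadamardTerm hf.1 hg.1 k).differentiableOn
  have h1 : DifferentiableAt ℂ (hadamardSeries f g) z :=
    (Complex.differentiableOn_tsum_of_summable_norm hu hD Metric.isOpen_ball h).differentiableAt
      (Metric.isOpen_ball.mem_nhds hz)
  have h2 := Complex.hasSum_deriv_of_summable_norm hu hD Metric.isOpen_ball h hz
  refine h1.hasDerivAt.congr_deriv ?_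
  refine h2.unique ?_
  simp only [(hasDerivAt_hadamardTerm hf.1 hg.1 _ z).deriv]
  refine HasSum.add ?_ ((hf.deriv.summable_hadamardTerm hg z).hasSum.add
    (hf.summable_hadamardTerm hg.deriv z).hasSum)
  -- Differentiating `zᵏ/k!` kills the term `k = 0` and lowers the index by one, which turns the
  -- rest into the series for `f'` and `g'`.
  rw [← hasSum_nat_add_iff' 1]
  simp only [Finset.range_one, Finset.sum_singleton, Nat.cast_zero, zero_mul, zero_div, sub_zero]
  have e : (fun k : ℕ => ((k + 1 : ℕ) : ℂ) * z ^ (k + 1 - 1) / ((k + 1)! : ℂ) *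
      (iteratedDeriv (k + 1) f z * iteratedDeriv (k + 1) g z)) =
      fun k => hadamardTerm (_root_.deriv f) (_root_.deriv g) k z := by
    funext k
    have hk : ((k : ℂ) + 1) ≠ 0 := by exact_mod_cast k.succ_ne_zero
    have hk' : (k ! : ℂ) ≠ 0 := by exact_mod_cast k.factorial_ne_zero
    rw [hadamardTerm, iteratedDeriv_succ', iteratedDeriv_succ', Nat.factorial_succ]
    push_cast
    field_simp
  rw [e]
  exact (hf.deriv.summable_hadamardTerm hg.deriv z).hasSum

theorem hadamardSeries_add_left {f₁ f₂ g : ℂ → ℂ} (hf₁ : IsExpType f₁) (hf₂ : IsExpType f₂)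
    (hg : IsExpType g) (z : ℂ) :
    hadamardSeries (f₁ + f₂) g z = hadamardSeries f₁ g z + hadamardSeries f₂ g z := by
  rw [hadamardSeries, hadamardSeries, hadamardSeries,
    ← (hf₁.summable_hadamardTerm hg z).tsum_add (hf₂.summable_hadamardTerm hg z)]
  refine tsum_congr fun k => ?_
  rw [hadamardTerm, hadamardTerm, hadamardTerm, iteratedDeriv_add
    (hf₁.1.contDiff.contDiffAt) (hf₂.1.contDiff.contDiffAt)]
  ring

theorem hadamardSeries_comm (f g : ℂ → ℂ) (z : ℂ) :
    hadamardSeries f g z = hadamardSeries g f z :=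
  tsum_congr fun k => by rw [hadamardTerm, hadamardTerm, mul_comm (iteratedDeriv k f z)]

theorem hadamardSeries_add_right {f g₁ g₂ : ℂ → ℂ} (hf : IsExpType f) (hg₁ : IsExpType g₁)
    (hg₂ : IsExpType g₂) (z : ℂ) :
    hadamardSeries f (g₁ + g₂) z = hadamardSeries f g₁ z + hadamardSeries f g₂ z := by
  rw [hadamardSeries_comm, hadamardSeries_add_left hg₁ hg₂ hf, hadamardSeries_comm f,
    hadamardSeries_comm f]

theorem IsExpType.differentiable_hadamardSeries {f g : ℂ → ℂ} (hf : IsExpType f)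
    (hg : IsExpType g) : Differentiable ℂ (hadamardSeries f g) :=
  fun z => (hf.hasDerivAt_hadamardSeries hg z).differentiableAt

theorem deriv_exp_mul {f : ℂ → ℂ} (hf : Differentiable ℂ f) :
    (deriv fun z => Complex.exp z * f z) = fun z => Complex.exp z * (f + deriv f) z := by
  funext z
  rw [Pi.add_apply, mul_add]
  exact ((Complex.hasDerivAt_exp z).mul (hf z).hasDerivAt).deriv

/-- By bilinearity the series and the three parts of its derivative are the expansion of a single
series in `f + f'` and `g + g'`. -/
theorem IsExpType.deriv_exp_mul_hadamardSeries {f g : ℂ → ℂ} (hf : IsExpType f)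
    (hg : IsExpType g) : (_root_.deriv fun z => Complex.exp z * hadamardSeries f g z) =
      fun z => Complex.exp z * hadamardSeries (f + _root_.deriv f) (g + _root_.deriv g) z := by
  rw [deriv_exp_mul (hf.differentiable_hadamardSeries hg)]
  funext z
  rw [Pi.add_apply, (hf.hasDerivAt_hadamardSeries hg z).deriv,
    hadamardSeries_add_left hf hf.deriv (hg.add hg.deriv),
    hadamardSeries_add_right hf hg hg.deriv, hadamardSeries_add_right hf.deriv hg hg.deriv]
  ring

theorem hadamardSeries_zero (f g : ℂ → ℂ) : hadamardSeries f g 0 = f 0 * g 0 := by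
  rw [hadamardSeries, tsum_eq_single 0]
  · simp [hadamardTerm]
  · intro k hk
    simp [hadamardTerm, hk]

theorem poissonCoeff_succ {f : ℂ → ℂ} (hf : Differentiable ℂ f) (n : ℕ) :
    poissonCoeff f (n + 1) = poissonCoeff (f + deriv f) n := by
  rw [poissonCoeff, poissonCoeff, iteratedDeriv_succ', deriv_exp_mul hf]

/-- The functions vary in the induction, because each step replaces them by `f + f'` and `g + g'`.
-/
theorem IsExpType.poissonCoeff_hadamardSeries (n : ℕ) : ∀ {f g : ℂ → ℂ}, IsExpType f →
    IsExpType g → poissonCoeff (hadamardSeries f g) n = poissonCoeff f n * poissonCoeff g n := by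
  induction n with
  | zero => intro f g _ _; simp [poissonCoeff, hadamardSeries_zero]
  | succ n ih =>
    intro f g hf hg
    rw [poissonCoeff_succ hf.1, poissonCoeff_succ hg.1, ← ih (hf.add hf.deriv) (hg.add hg.deriv),
      poissonCoeff, poissonCoeff, iteratedDeriv_succ', hf.deriv_exp_mul_hadamardSeries hg]

/-- The Hadamard product of Poisson generating functions is `∑ zᵏ/k! f⁽ᵏ⁾(z) g⁽ᵏ⁾(z)`. -/
theorem IsExpType.poissonHadamard_eq {f g : ℂ → ℂ} (hf : IsExpType f) (hg : IsExpType g) :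
    poissonHadamard f g = hadamardSeries f g := by
  rw [← poissonGF_poissonCoeff (hf.differentiable_hadamardSeries hg), poissonHadamard]
  congr 1
  funext n
  exact (poissonCoeff_hadamardSeries n hf hg).symm

theorem IsExpType.hasSum_poissonHadamard {f g : ℂ → ℂ} (hf : IsExpType f) (hg : IsExpType g)
    (z : ℂ) : HasSum (fun n : ℕ => poissonCoeff f n * poissonCoeff g n / (n ! : ℂ) * z ^ n)
      (Complex.exp z * poissonHadamard f g z) := by
  have := hasSum_poissonCoeff (hf.differentiable_hadamardSeries hg) z
  simp only [poissonCoeff_hadamardSeries _ hf hg] at this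
  rwa [hf.poissonHadamard_eq hg]

end HadamardSeries

/-! ### Derivative estimates in a narrow cone -/

section InnerCone

/-- A crude Stirling bound; the induction step is `(1 - 1/(k+1))^(k+1) ≤ e⁻¹`. -/
theorem factorial_mul_exp_le {k : ℕ} (hk : 1 ≤ k) :
    (k ! : ℝ) * Real.exp k ≤ Real.exp 1 * k * (k : ℝ) ^ k := by
  induction k, hk using Nat.le_induction with
  | base => simp
  | succ k hk ih =>
    have hk0 : (0 : ℝ) < k := by exact_mod_cast hk
    have h1 : (k : ℝ) / (k + 1) ≤ Real.exp (-(1 / ((k : ℝ) + 1))) := by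
      refine le_trans (le_of_eq ?_) (Real.one_sub_le_exp_neg _)
      field_simp
      ring
    have e1 : ((k + 1 : ℕ) : ℝ) * -(1 / ((k : ℝ) + 1)) = -1 := by
      push_cast
      field_simp
    have h2 : (k : ℝ) ^ (k + 1) ≤ Real.exp (-1) * (k + 1) ^ (k + 1) := by
      have := pow_le_pow_left₀ (by positivity) h1 (k + 1)
      rwa [← Real.exp_nat_mul, div_pow, div_le_iff₀ (by positivity), e1] at this
    rw [Nat.factorial_succ]
    push_cast
    calc ((k : ℝ) + 1) * (k ! : ℝ) * Real.exp (k + 1)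
        = (k + 1) * Real.exp 1 * ((k ! : ℝ) * Real.exp k) := by rw [Real.exp_add]; ring
      _ ≤ (k + 1) * Real.exp 1 * (Real.exp 1 * k * (k : ℝ) ^ k) := by gcongr
      _ = (k + 1) * Real.exp 1 * Real.exp 1 * (k : ℝ) ^ (k + 1) := by ring
      _ ≤ (k + 1) * Real.exp 1 * Real.exp 1 * (Real.exp (-1) * (k + 1) ^ (k + 1)) := by gcongr
      _ = (k + 1) * Real.exp 1 * (Real.exp 1 * Real.exp (-1)) * (k + 1) ^ (k + 1) := by ring
      _ = _ := by rw [← Real.exp_add, add_neg_cancel, Real.exp_zero]; ring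

theorem factorial_mul_two_pow_le {x : ℝ} (n : ℕ) (h : 2 * ((n : ℝ) + 2) ≤ x) :
    ((n + 2)! : ℝ) * 2 ^ n ≤ 2 * x ^ n := by
  induction n with
  | zero => simp
  | succ n ih =>
    push_cast at h
    have hn : (0 : ℝ) ≤ n := n.cast_nonneg
    have h1 := ih (by linarith)
    rw [show n + 1 + 2 = (n + 2) + 1 by ring, Nat.factorial_succ]
    push_cast
    calc ((n : ℝ) + 2 + 1) * ((n + 2)! : ℝ) * 2 ^ (n + 1)
        = (2 * (n + 3)) * (((n + 2)! : ℝ) * 2 ^ n) := by ring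
      _ ≤ x * (2 * x ^ n) := by
          refine mul_le_mul (by linarith) h1 (by positivity) (by linarith)
      _ = _ := by ring

theorem ConeBound.isExpType {c ε α β C : ℝ} {f : ℂ → ℂ} (h : ConeBound c ε α β C f)
    (hC : 0 < C) (hε : 0 < ε) : IsExpType f := by
  obtain ⟨A, hA, hA'⟩ := h.exists_norm_le_exp hC one_pos
  refine ⟨h.entire, A + C, 2, by norm_num, fun z => ?_⟩
  have hp := Real.exp_pos (2 * ‖z‖)
  rcases le_total z.re (c * ‖z‖) with h1 | h1
  · have h2 : ‖f z‖ = Real.exp (-z.re) * ‖Complex.exp z * f z‖ := by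
      rw [norm_mul, Complex.norm_exp, ← mul_assoc, ← Real.exp_add]; simp
    have h3 : Real.exp (-z.re) * (C * Real.exp ((1 - ε) * ‖z‖)) ≤ C * Real.exp (2 * ‖z‖) := by
      rw [mul_left_comm, ← Real.exp_add]
      gcongr
      have := Complex.abs_re_le_norm z
      have := neg_abs_le z.re
      nlinarith [norm_nonneg z]
    rw [h2]
    have h4 := mul_le_mul_of_nonneg_left (h.expBound z h1) (Real.exp_pos (-z.re)).le
    nlinarith
  · have h2 := hA' z h1
    have h3 : Real.exp (1 * ‖z‖) ≤ Real.exp (2 * ‖z‖) := by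
      gcongr
      norm_num
    nlinarith

/-- Derivatives in a smaller cone, from Cauchy's estimate on a circle of radius `δ‖z‖`. -/
theorem ConeBound.norm_iteratedDeriv_le {c ε α β C c₁ δ : ℝ} {f : ℂ → ℂ}
    (h : ConeBound c ε α β C f) (hC : 0 < C) (hc : 0 < c) (hδ : 0 < δ) (hδ1 : δ ≤ 1 / 2)
    (hδ2 : c * (1 + δ) ≤ c₁ - δ) (k : ℕ) {z : ℂ} (hz : 1 ≤ ‖z‖) (hz1 : c₁ * ‖z‖ ≤ z.re) :
    ‖iteratedDeriv k f z‖ ≤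
      (k ! : ℝ) * (C * (2 ^ |α| * 2 ^ |β|) * growthScale α β ‖z‖) / (δ * ‖z‖) ^ k := by
  refine norm_iteratedDeriv_le_of_sphere h.entire k (by positivity) fun w hw => ?_
  have h1 : ‖w‖ ≤ ‖z‖ + δ * ‖z‖ := by
    rw [← hw]; simpa using norm_add_le z (w - z)
  have h2 : ‖z‖ ≤ ‖w‖ + δ * ‖z‖ := by
    rw [← hw, norm_sub_rev]; simpa using norm_add_le w (z - w)
  have h3 : z.re - w.re ≤ δ * ‖z‖ := by
    rw [← hw, norm_sub_rev]
    exact (Complex.re_le_norm (z - w))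
  -- `hδ2` keeps the circle in the larger cone: `c‖w‖ ≤ c(1 + δ)‖z‖ ≤ (c₁ - δ)‖z‖ ≤ w.re`.
  have h4 : c * ‖w‖ ≤ w.re := by nlinarith
  refine (h.growth w (by nlinarith) h4).trans ?_
  rw [mul_assoc C]
  refine mul_le_mul_of_nonneg_left (growthScale_le_mul (by linarith) ?_ ?_) hC.le
  · nlinarith
  · nlinarith

/-- For real `z > 0`, `kz = (‖w‖ - z)² + 2z(‖w‖ - w.re)`, so the left side times `z` is `kz/2 - (‖w‖
- z)²/2 - ε‖w‖z`. Tilting `z` within the cone costs at most `ε‖w‖‖z‖/2`. The remaining loss covers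
`εk‖z‖/8`, as `k‖z‖ ≤ (‖w‖ - ‖z‖)² + 4‖w‖‖z‖`. -/
theorem exponent_le_of_norm_sub_eq {ε c₁ : ℝ} (hε1 : ε ≤ 1) (hε : 0 < ε)
    (hc₁ : 2 * (1 - c₁) ≤ (ε / 2) ^ 2) {z w : ℂ} {k : ℝ} (hz : 0 < ‖z‖)
    (hz1 : c₁ * ‖z‖ ≤ z.re) (hw : ‖w - z‖ ^ 2 = k * ‖z‖) :
    (1 - ε) * ‖w‖ - w.re ≤ (1 / 2 - ε / 8) * k := by
  have hwz : ‖w - z‖ ≤ ‖w‖ + ‖z‖ := norm_sub_le w z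
  have hk : k * ‖z‖ ≤ (‖w‖ + ‖z‖) ^ 2 := by
    rw [← hw]; exact pow_le_pow_left₀ (norm_nonneg _) hwz 2
  have e1 : ‖z‖ ^ 2 = z.re ^ 2 + z.im ^ 2 := by
    rw [Complex.sq_norm, Complex.normSq_apply]; ring
  have e2 : ‖w‖ ^ 2 = w.re ^ 2 + w.im ^ 2 := by
    rw [Complex.sq_norm, Complex.normSq_apply]; ring
  have e3 : k * ‖z‖ = ‖w‖ ^ 2 + ‖z‖ ^ 2 - 2 * (w.re * z.re + w.im * z.im) := by
    rw [← hw, Complex.sq_norm, Complex.normSq_apply, e1, e2]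
    simp only [Complex.sub_re, Complex.sub_im]; ring
  have h1 : ‖(‖z‖ : ℂ) - z‖ ≤ ε / 2 * ‖z‖ := by
    refine abs_le_of_sq_le_sq' ?_ (by positivity) |>.2
    rw [Complex.sq_norm, Complex.normSq_apply]
    simp only [Complex.sub_re, Complex.sub_im, Complex.ofReal_re, Complex.ofReal_im]
    nlinarith
  have h2 : w.re * z.re + w.im * z.im - ‖z‖ * w.re ≤ ‖w‖ * (ε / 2 * ‖z‖) := by
    have h3 := Complex.re_le_norm (-((starRingEnd ℂ) w * ((‖z‖ : ℂ) - z)))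
    rw [norm_neg, norm_mul, Complex.norm_conj] at h3
    simp only [Complex.neg_re, Complex.mul_re, Complex.conj_re, Complex.conj_im, Complex.sub_re,
      Complex.sub_im, Complex.ofReal_re, Complex.ofReal_im] at h3
    have h4 := mul_le_mul_of_nonneg_left h1 (norm_nonneg w)
    linarith
  have h5 : ((1 - ε) * ‖w‖ - w.re) * ‖z‖ ≤ (1 / 2 - ε / 8) * k * ‖z‖ := by
    have h6 : ε / 8 * (k * ‖z‖) ≤ ε / 8 * (‖w‖ + ‖z‖) ^ 2 := by gcongr
    have h7 : 0 ≤ (1 / 2 - ε / 8) * (‖w‖ - ‖z‖) ^ 2 :=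
      mul_nonneg (by linarith) (sq_nonneg _)
    linarith
  exact le_of_mul_le_mul_right h5 hz

/-- High derivatives in a smaller cone, from Cauchy's estimate on a circle of radius
`√(k‖z‖)`. -/
theorem ConeBound.exists_norm_iteratedDeriv_le_sqrt {c ε α β C c₁ d : ℝ} {f : ℂ → ℂ}
    (h : ConeBound c ε α β C f) (hC : 0 < C) (hε1 : ε ≤ 1) (hε : 0 < ε)
    (hc₁ : 2 * (1 - c₁) ≤ (ε / 2) ^ 2) (hd : 0 < d) :
    ∃ A : ℝ, 0 < A ∧ ∀ (k : ℕ) (z : ℂ), 1 ≤ ‖z‖ → c₁ * ‖z‖ ≤ z.re → d * ‖z‖ ≤ k →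
      ‖iteratedDeriv k f z‖ ≤
        (k ! : ℝ) * (A * Real.exp ((1 / 2 - ε / 8) * k)) / √(k * ‖z‖) ^ k := by
  -- The circle lies in `‖w‖ ≤ k(1 + 2/d)`, so this rate gives at most `e^(k/4)`, and `1/4 ≤ 1/2 -
  -- ε/8`.
  have hη : 0 < (1 / 4) / (1 + 2 / d) := by positivity
  obtain ⟨A, hA, hA'⟩ := h.exists_norm_le_exp hC hη
  refine ⟨A + C, by positivity, fun k z hz hz1 hk => ?_⟩
  have hz0 : 0 < ‖z‖ := by linarith
  have hk0 : (0 : ℝ) < k := lt_of_lt_of_le (by positivity) hk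
  refine norm_iteratedDeriv_le_of_sphere h.entire k (by positivity) fun w hw => ?_
  have hp := Real.exp_pos ((1 / 2 - ε / 8) * k)
  rcases le_total w.re (c * ‖w‖) with h1 | h1
  · have h2 : ‖f w‖ = Real.exp (-w.re) * ‖Complex.exp w * f w‖ := by
      rw [norm_mul, Complex.norm_exp, ← mul_assoc, ← Real.exp_add]; simp
    have h3 := exponent_le_of_norm_sub_eq hε1 hε hc₁ (w := w) (k := k) hz0 hz1 (by
      rw [hw, Real.sq_sqrt (by positivity)])
    calc ‖f w‖ ≤ Real.exp (-w.re) * (C * Real.exp ((1 - ε) * ‖w‖)) := by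
          rw [h2]
          exact mul_le_mul_of_nonneg_left (h.expBound w h1) (Real.exp_pos _).le
      _ = C * Real.exp ((1 - ε) * ‖w‖ - w.re) := by
          rw [mul_left_comm, ← Real.exp_add]; ring_nf
      _ ≤ (A + C) * Real.exp ((1 / 2 - ε / 8) * k) := by
          gcongr
          linarith
  · have h2 : ‖z‖ ≤ k / d := by rw [le_div_iff₀ hd]; linarith
    have h3 : √(k * ‖z‖) ≤ k + k / d := by
      rw [Real.sqrt_le_left (by positivity)]
      have : (k : ℝ) * ‖z‖ ≤ k * (k / d) := by gcongr
      nlinarith [sq_nonneg ((k : ℝ)), sq_nonneg ((k : ℝ) / d), mul_pos hk0 (div_pos hk0 hd)]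
    have h4 : ‖w‖ ≤ k * (1 + 2 / d) := by
      have : ‖w‖ ≤ ‖z‖ + √(k * ‖z‖) := by
        rw [← hw]; simpa using norm_add_le z (w - z)
      calc ‖w‖ ≤ k / d + (k + k / d) := by linarith
        _ = _ := by ring
    refine (hA' w h1).trans (mul_le_mul (by linarith) ?_ (Real.exp_pos _).le (by positivity))
    refine Real.exp_le_exp.mpr ?_
    calc (1 / 4) / (1 + 2 / d) * ‖w‖ ≤ (1 / 4) / (1 + 2 / d) * (k * (1 + 2 / d)) := by gcongr
      _ = 1 / 4 * k := by field_simp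
      _ ≤ _ := by gcongr; linarith

end InnerCone

/-! ### The remainder of the expansion -/

section Remainder

/-- Two Cauchy estimates against one `1/k!` leave a single factorial. The ratio `‖z‖/ρ²` is
`1/(δ²‖z‖)` for `ρ = δ‖z‖` and `1/k` for `ρ = √(k‖z‖)`. -/
theorem norm_hadamardTerm_le {f g : ℂ → ℂ} {k : ℕ} {z : ℂ} {a b ρ : ℝ}
    (hf : ‖iteratedDeriv k f z‖ ≤ (k ! : ℝ) * a / ρ ^ k)
    (hg : ‖iteratedDeriv k g z‖ ≤ (k ! : ℝ) * b / ρ ^ k) :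
    ‖hadamardTerm f g k z‖ ≤ (k ! : ℝ) * (a * b) * (‖z‖ / ρ ^ 2) ^ k := by
  have hk : (0 : ℝ) < k ! := by exact_mod_cast k.factorial_pos
  rw [hadamardTerm, norm_mul, norm_mul, norm_div, norm_pow, Complex.norm_natCast]
  calc ‖z‖ ^ k / (k ! : ℝ) * (‖iteratedDeriv k f z‖ * ‖iteratedDeriv k g z‖)
      ≤ ‖z‖ ^ k / (k ! : ℝ) * ((k ! : ℝ) * a / ρ ^ k * ((k ! : ℝ) * b / ρ ^ k)) := by
        refine mul_le_mul_of_nonneg_left ?_ (by positivity)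
        exact mul_le_mul hf hg (norm_nonneg _) ((norm_nonneg _).trans hf)
    _ = _ := by
        rw [div_pow, ← pow_mul, mul_comm 2 k, pow_mul]
        field_simp

/-- Bound for the terms of low order. -/
theorem norm_hadamardTerm_le_geometric {f g : ℂ → ℂ} {n : ℕ} {z : ℂ} {a b δ : ℝ} (hδ : 0 < δ)
    (hz : 0 < ‖z‖) (ha : 0 ≤ a) (hb : 0 ≤ b) (hn : 2 * ((n : ℝ) + 2) ≤ δ ^ 2 * ‖z‖)
    (hf : ‖iteratedDeriv (n + 2) f z‖ ≤ ((n + 2)! : ℝ) * a / (δ * ‖z‖) ^ (n + 2))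
    (hg : ‖iteratedDeriv (n + 2) g z‖ ≤ ((n + 2)! : ℝ) * b / (δ * ‖z‖) ^ (n + 2)) :
    ‖hadamardTerm f g (n + 2) z‖ ≤ 2 * (a * b) / (δ ^ 2 * ‖z‖) ^ 2 * (1 / 2) ^ n := by
  refine (norm_hadamardTerm_le hf hg).trans ?_
  have h1 := factorial_mul_two_pow_le n hn
  have e : ‖z‖ / (δ * ‖z‖) ^ 2 = 1 / (δ ^ 2 * ‖z‖) := by field_simp
  rw [e]
  set x := δ ^ 2 * ‖z‖ with hx
  have hx0 : 0 < x := by positivity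
  calc ((n + 2)! : ℝ) * (a * b) * (1 / x) ^ (n + 2)
      = (a * b) * (((n + 2)! : ℝ) * 2 ^ n) * ((1 / x) ^ (n + 2) * (1 / 2) ^ n) := by
        rw [div_pow 1 2 n, one_pow]; field_simp
    _ ≤ (a * b) * (2 * x ^ n) * ((1 / x) ^ (n + 2) * (1 / 2) ^ n) := by gcongr
    _ = _ := by
        rw [div_pow, one_pow, pow_add]
        field_simp

/-- Bound for the terms of high order. -/
theorem norm_hadamardTerm_le_exp {f g : ℂ → ℂ} {k : ℕ} {z : ℂ} {A B ε : ℝ} (hk : 1 ≤ k)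
    (hε : 0 < ε) (hz : 0 < ‖z‖) (hA : 0 ≤ A) (hB : 0 ≤ B)
    (hf : ‖iteratedDeriv k f z‖ ≤
      (k ! : ℝ) * (A * Real.exp ((1 / 2 - ε / 8) * k)) / √(k * ‖z‖) ^ k)
    (hg : ‖iteratedDeriv k g z‖ ≤
      (k ! : ℝ) * (B * Real.exp ((1 / 2 - ε / 8) * k)) / √(k * ‖z‖) ^ k) :
    ‖hadamardTerm f g k z‖ ≤ A * B * Real.exp 1 * (8 / ε) * Real.exp (-(ε / 8 * k)) := by
  refine (norm_hadamardTerm_le hf hg).trans ?_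
  have hk0 : (0 : ℝ) < k := by exact_mod_cast hk
  have h1 := factorial_mul_exp_le hk
  have e : ‖z‖ / √(k * ‖z‖) ^ 2 = 1 / k := by
    rw [Real.sq_sqrt (by positivity)]; field_simp
  have e2 : A * Real.exp ((1 / 2 - ε / 8) * k) * (B * Real.exp ((1 / 2 - ε / 8) * k)) =
      A * B * (Real.exp k * Real.exp (-(ε / 4 * k))) := by
    rw [← Real.exp_add, mul_mul_mul_comm, ← Real.exp_add]; ring_nf
  -- The factor `k` from the Stirling bound is absorbed by half of the decay `e^(-εk/4)`.
  have h2 : (k : ℝ) ≤ 8 / ε * Real.exp (ε / 8 * k) := by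
    have := Real.add_one_le_exp (ε / 8 * k)
    calc (k : ℝ) = 8 / ε * (ε / 8 * k) := by field_simp
      _ ≤ _ := by gcongr; linarith
  rw [e, e2]
  calc (k ! : ℝ) * (A * B * (Real.exp k * Real.exp (-(ε / 4 * k)))) * (1 / k) ^ k
      = A * B * ((k ! : ℝ) * Real.exp k) * Real.exp (-(ε / 4 * k)) * (1 / k) ^ k := by ring
    _ ≤ A * B * (Real.exp 1 * k * (k : ℝ) ^ k) * Real.exp (-(ε / 4 * k)) * (1 / k) ^ k := by
        gcongr
    _ = A * B * Real.exp 1 * k * Real.exp (-(ε / 4 * k)) := by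
        rw [div_pow, one_pow]; field_simp
    _ ≤ A * B * Real.exp 1 * (8 / ε * Real.exp (ε / 8 * k)) * Real.exp (-(ε / 4 * k)) := by
        gcongr
    _ = A * B * Real.exp 1 * (8 / ε) * (Real.exp (ε / 8 * k) * Real.exp (-(ε / 4 * k))) := by ring
    _ = _ := by rw [← Real.exp_add]; ring_nf

theorem exists_exp_le_growthScale (a b : ℝ) {η : ℝ} (hη : 0 < η) :
    ∃ C : ℝ, 0 < C ∧ ∀ r : ℝ, 1 / 2 ≤ r → Real.exp (-(η * r)) ≤ C * growthScale a b r := by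
  obtain ⟨C, hC, h⟩ := exists_growthScale_le_exp (-a) (-b) hη
  refine ⟨C, hC, fun r hr => ?_⟩
  have hr0 : 0 < r := by linarith
  have h3 : growthScale a b r * growthScale (-a) (-b) r = 1 := by
    rw [growthScale_mul hr0]; simp [growthScale]
  have h4 := mul_le_mul_of_nonneg_left (h r hr) (growthScale_pos (a := a) (b := b) hr0).le
  rw [h3] at h4
  rw [Real.exp_neg, inv_le_iff_one_le_mul₀ (Real.exp_pos _)]
  linarith

theorem growthScale_sub_two {a b r : ℝ} (hr : 0 < r) :
    growthScale (a - 2) b r = growthScale a b r / r ^ 2 := by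
  rw [growthScale, growthScale, Real.rpow_sub hr, Real.rpow_two]; ring

/-- The first two terms of the expansion of the Hadamard product, with the error, in a cone. -/
theorem ConeBound.exists_hadamardSeries_sub_le {c ε α₁ β₁ α₂ β₂ C c₁ δ : ℝ} {f g : ℂ → ℂ}
    (hf : ConeBound c ε α₁ β₁ C f) (hg : ConeBound c ε α₂ β₂ C g) (hC : 0 < C) (hc : 0 < c)
    (hε : 0 < ε) (hε1 : ε ≤ 1) (hδ : 0 < δ) (hδ1 : δ ≤ 1 / 2) (hδ2 : c * (1 + δ) ≤ c₁ - δ)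
    (hc₁ : 2 * (1 - c₁) ≤ (ε / 2) ^ 2) :
    ∃ D : ℝ, 0 < D ∧ ∀ z : ℂ, 1 ≤ ‖z‖ → c₁ * ‖z‖ ≤ z.re →
      ‖hadamardSeries f g z - (f z * g z + z * deriv f z * deriv g z)‖ ≤
        D * growthScale (α₁ + α₂ - 2) (β₁ + β₂) ‖z‖ := by
  -- With `d = δ²/2` the condition `k ≥ d‖z‖` takes over where `2k ≤ δ²‖z‖` ends.
  obtain ⟨A, hA, hA'⟩ := hf.exists_norm_iteratedDeriv_le_sqrt hC hε1 hε hc₁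
    (d := δ ^ 2 / 2) (by positivity)
  obtain ⟨B, hB, hB'⟩ := hg.exists_norm_iteratedDeriv_le_sqrt hC hε1 hε hc₁
    (d := δ ^ 2 / 2) (by positivity)
  -- The decay `e^(-εk/8)` is split in halves: one makes the sum over `n` converge, the other, by `k
  -- ≥ δ²‖z‖/2`, is below the target scale.
  obtain ⟨E, hE, hE'⟩ := exists_exp_le_growthScale (α₁ + α₂ - 2) (β₁ + β₂)
    (η := ε / 16 * (δ ^ 2 / 2)) (by positivity)
  set a := C * (2 ^ |α₁| * 2 ^ |β₁|) with ha
  set b := C * (2 ^ |α₂| * 2 ^ |β₂|) with hb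
  have ha0 : 0 < a := by positivity
  have hb0 : 0 < b := by positivity
  set q := Real.exp (-(ε / 16)) with hq
  have hq1 : q < 1 := Real.exp_lt_one_iff.mpr (by linarith)
  set P := 2 * (a * b) / δ ^ 4 with hP
  set Q := A * B * Real.exp 1 * (8 / ε) with hQ
  have hq0 : 0 < 1 - q := by linarith
  have hP0 : 0 < P := by positivity
  have hQ0 : 0 < Q := by positivity
  refine ⟨P * 2 + Q * E * (1 - q)⁻¹, by positivity, fun z hz hz1 => ?_⟩
  have hz0 : 0 < ‖z‖ := by linarith
  set W := growthScale (α₁ + α₂ - 2) (β₁ + β₂) ‖z‖ with hW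
  have hW0 : 0 < W := growthScale_pos hz0
  have hsum := (hf.isExpType hC hε).summable_hadamardTerm (hg.isExpType hC hε) z
  have h1 : hadamardSeries f g z - (f z * g z + z * deriv f z * deriv g z) =
      ∑' n, hadamardTerm f g (n + 2) z := by
    rw [hadamardSeries, ← hsum.sum_add_tsum_nat_add 2, Finset.sum_range_succ, Finset.sum_range_one]
    simp [hadamardTerm]
    ring
  have hterm : ∀ n : ℕ, ‖hadamardTerm f g (n + 2) z‖ ≤
      P * W * (1 / 2) ^ n + Q * E * W * q ^ n := by
    intro n
    rcases le_total (2 * ((n : ℝ) + 2)) (δ ^ 2 * ‖z‖) with hn | hn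
    · have h2 := norm_hadamardTerm_le_geometric hδ hz0
        (mul_pos ha0 (growthScale_pos hz0)).le (mul_pos hb0 (growthScale_pos hz0)).le hn
        (hf.norm_iteratedDeriv_le hC hc hδ hδ1 hδ2 (n + 2) hz hz1)
        (hg.norm_iteratedDeriv_le hC hc hδ hδ1 hδ2 (n + 2) hz hz1)
      have e : 2 * (a * growthScale α₁ β₁ ‖z‖ * (b * growthScale α₂ β₂ ‖z‖)) /
          (δ ^ 2 * ‖z‖) ^ 2 = P * W := by
        rw [mul_mul_mul_comm, growthScale_mul hz0, hW, growthScale_sub_two hz0, hP]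
        field_simp
      rw [e] at h2
      have : 0 ≤ Q * E * W * q ^ n := by positivity
      linarith
    · have hk : δ ^ 2 / 2 * ‖z‖ ≤ ((n + 2 : ℕ) : ℝ) := by push_cast; linarith
      have h2 := norm_hadamardTerm_le_exp (by omega) hε hz0 hA.le hB.le
        (hA' (n + 2) z hz hz1 hk) (hB' (n + 2) z hz hz1 hk)
      have h3 : Real.exp (-(ε / 8 * ((n + 2 : ℕ) : ℝ))) ≤ E * W * q ^ n := by
        calc Real.exp (-(ε / 8 * ((n + 2 : ℕ) : ℝ)))
            ≤ Real.exp (-(ε / 16 * (δ ^ 2 / 2) * ‖z‖)) * q ^ n := by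
              rw [hq, ← Real.exp_nat_mul, ← Real.exp_add]
              refine Real.exp_le_exp.mpr ?_
              have := mul_le_mul_of_nonneg_left hk (show 0 ≤ ε / 16 by positivity)
              push_cast at this ⊢
              linarith
          _ ≤ _ := by
              gcongr
              exact hE' _ (by linarith)
      have h4 := mul_le_mul_of_nonneg_left h3 hQ0.le
      have : 0 ≤ P * W * (1 / 2) ^ n := by positivity
      linarith
  have hs1 : HasSum (fun n : ℕ => ((1 : ℝ) / 2) ^ n) 2 := hasSum_geometric_two
  have hs2 : HasSum (fun n : ℕ => q ^ n) (1 - q)⁻¹ :=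
    hasSum_geometric_of_lt_one (Real.exp_pos _).le hq1
  rw [h1]
  refine (tsum_of_norm_bounded ((hs1.mul_left (P * W)).add (hs2.mul_left (Q * E * W)))
    hterm).trans (le_of_eq ?_)
  ring

end Remainder

/-! ### Integral representation and the bound outside the cone -/

section OuterRegion

open MeasureTheory

theorem HasSum.of_eq {a b : ℕ → ℂ} {s : ℂ} (h : HasSum a s) (e : ∀ n, a n = b n) :
    HasSum b s := (funext e : a = b) ▸ h

/-- Cauchy's formula for `w ↦ G (x * w)` on the unit circle, which also covers `x = 0`. -/
theorem integral_exp_neg_mul_I_mul {G : ℂ → ℂ} (hG : Differentiable ℂ G) (x : ℂ) (n : ℕ) :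
    ∫ θ in (0 : ℝ)..2 * Real.pi, Complex.exp (-(θ * Complex.I)) ^ n *
      G (x * Complex.exp (θ * Complex.I)) =
      2 * Real.pi * (iteratedDeriv n G 0 / (n ! : ℂ) * x ^ n) := by
  have hd : Differentiable ℂ fun w => G (x * w) := hG.comp (differentiable_id.const_mul x)
  have h := (hd.diffContOnCl (s := Metric.ball (0 : ℂ) 1)).circleIntegral_one_div_sub_center_pow_smul
    one_pos n
  rw [circleIntegral, iteratedDeriv_comp_const_mul (hG.contDiff)] at h
  simp only [sub_zero, deriv_circleMap, smul_eq_mul, mul_zero] at h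
  have hI := Complex.I_ne_zero
  have e : ∀ θ : ℝ, circleMap 0 1 θ * Complex.I * (1 / circleMap 0 1 θ ^ (n + 1) *
      G (x * circleMap 0 1 θ)) = Complex.I * (Complex.exp (-(θ * Complex.I)) ^ n *
      G (x * Complex.exp (θ * Complex.I))) := by
    intro θ
    have h0 := Complex.exp_ne_zero (θ * Complex.I)
    simp only [circleMap, zero_add, Complex.ofReal_one, one_mul]
    rw [Complex.exp_neg, inv_pow, pow_succ]
    field_simp
  simp only [e] at h
  rw [intervalIntegral.integral_const_mul] at h
  refine mul_left_cancel₀ hI (h.trans ?_)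
  ring

/-- Circle integral for the coefficientwise product of two power series. -/
theorem hasSum_integral_circle {F G : ℂ → ℂ} {a : ℕ → ℂ}
    (hF : ∀ z, HasSum (fun n => a n * z ^ n) (F z)) (hG : Differentiable ℂ G) (x : ℂ) :
    HasSum (fun n : ℕ => a n * x ^ n * (2 * Real.pi * (iteratedDeriv n G 0 / (n ! : ℂ) * x ^ n)))
      (∫ θ in (0 : ℝ)..2 * Real.pi, F (x * Complex.exp (-(θ * Complex.I))) *
        G (x * Complex.exp (θ * Complex.I))) := by
  obtain ⟨M, hM, hM'⟩ := exists_norm_le_of_norm_le hG.continuous ‖x‖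
  have hGc := hG.continuous
  have key := intervalIntegral.hasSum_integral_of_dominated_convergence (μ := volume)
    (a := 0) (b := 2 * Real.pi)
    (F := fun (n : ℕ) (θ : ℝ) => a n * x ^ n * (Complex.exp (-(θ * Complex.I)) ^ n *
      G (x * Complex.exp (θ * Complex.I))))
    (f := fun θ : ℝ => F (x * Complex.exp (-(θ * Complex.I))) *
        G (x * Complex.exp (θ * Complex.I)))
    (fun n _ => ‖a n * x ^ n‖ * M) (fun n => by
      refine Continuous.aestronglyMeasurable ?_
      fun_prop)
    (fun n => Eventually.of_forall fun θ _ => by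
      rw [norm_mul, norm_mul (Complex.exp _ ^ n), norm_pow (Complex.exp _), ← neg_mul,
        ← Complex.ofReal_neg, Complex.norm_exp_ofReal_mul_I, one_pow, one_mul]
      refine mul_le_mul_of_nonneg_left (hM' _ ?_) (norm_nonneg _)
      rw [norm_mul, Complex.norm_exp_ofReal_mul_I, mul_one])
    (Eventually.of_forall fun θ _ => ((hF x).summable.norm).mul_right M)
    (by simp)
    (Eventually.of_forall fun θ _ => by
      refine ((hF (x * Complex.exp (-(θ * Complex.I)))).mul_right
        (G (x * Complex.exp (θ * Complex.I)))).of_eq fun n => ?_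
      rw [mul_pow]; ring)
  refine key.of_eq fun n => ?_
  rw [intervalIntegral.integral_const_mul, integral_exp_neg_mul_I_mul hG]

/-- Laplace transform of a power series. -/
theorem hasSum_laplace {c : ℕ → ℂ} (z : ℂ)
    (hc : Summable fun n => c n * (n ! : ℂ) * z ^ n) {K : ℝ → ℂ}
    (hK : ∀ t : ℝ, 0 < t → HasSum (fun n => c n * (z * t) ^ n) (K t)) :
    HasSum (fun n => c n * (n ! : ℂ) * z ^ n)
      (∫ t in Set.Ioi (0 : ℝ), (Real.exp (-t) : ℂ) * K t) := by
  have hint : ∀ n : ℕ, IntegrableOn (fun t : ℝ => Real.exp (-t) * t ^ n) (Set.Ioi 0) := by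
    intro n
    have := Real.GammaIntegral_convergent (s := n + 1) (by positivity)
    simpa using this
  have hval : ∀ n : ℕ, ∫ t in Set.Ioi (0 : ℝ), Real.exp (-t) * t ^ n = n ! := by
    intro n
    rw [← Real.Gamma_nat_eq_factorial, Real.Gamma_eq_integral (by positivity)]
    simp
  -- As `∫ e^(-t) tⁿ = n!`, the integrals of the norms sum to `∑ ‖cₙ n! zⁿ‖`, which is finite by
  -- `hc`.
  have key := hasSum_integral_of_summable_integral_norm (μ := volume.restrict (Set.Ioi (0 : ℝ)))
    (F := fun (n : ℕ) (t : ℝ) => c n * z ^ n * ((Real.exp (-t) * t ^ n : ℝ) : ℂ))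
    (fun n => ((hint n).ofReal).const_mul _) (by
      refine hc.norm.congr fun n => ?_
      have e : ∀ t ∈ Set.Ioi (0 : ℝ), ‖c n * z ^ n * ((Real.exp (-t) * t ^ n : ℝ) : ℂ)‖ =
          ‖c n * z ^ n‖ * (Real.exp (-t) * t ^ n) := by
        intro t ht
        have ht' : (0 : ℝ) < t := ht
        rw [norm_mul, Complex.norm_real, Real.norm_of_nonneg (by positivity)]
      rw [setIntegral_congr_fun measurableSet_Ioi e, integral_const_mul, hval, norm_mul, norm_mul,
        norm_mul, Complex.norm_natCast]
      ring)
  have e1 : (fun n : ℕ => ∫ t in Set.Ioi (0 : ℝ), c n * z ^ n *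
      ((Real.exp (-t) * t ^ n : ℝ) : ℂ)) = fun n => c n * (n ! : ℂ) * z ^ n := by
    funext n
    rw [integral_const_mul, integral_complex_ofReal, hval]
    push_cast
    ring
  rw [e1] at key
  have e2 : ∫ t in Set.Ioi (0 : ℝ), ∑' n, c n * z ^ n * ((Real.exp (-t) * t ^ n : ℝ) : ℂ) =
      ∫ t in Set.Ioi (0 : ℝ), (Real.exp (-t) : ℂ) * K t := by
    refine setIntegral_congr_fun measurableSet_Ioi fun t ht => ?_
    have h := ((hK t ht).mul_left ((Real.exp (-t) : ℝ) : ℂ)).tsum_eq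
    refine Eq.trans (tsum_congr fun n => ?_) h
    push_cast
    rw [mul_pow]
    ring
  rwa [e2] at key

/-- The double angle formula: arguments below `θ = arccos c` add up to less than `2θ`, and `cos 2θ =
2c² - 1`. -/
theorem re_mul_gt_of_cone {c : ℝ} (hc : 0 ≤ c) (hc1 : c ≤ 1) {u v : ℂ} (hu : c * ‖u‖ < u.re)
    (hv : c * ‖v‖ < v.re) : (2 * c ^ 2 - 1) * (‖u‖ * ‖v‖) < (u * v).re := by
  have h1 : c * ‖u‖ * (c * ‖v‖) < u.re * v.re :=
    mul_lt_mul'' hu hv (by positivity) (by positivity)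
  have him : ∀ w : ℂ, c * ‖w‖ < w.re → |w.im| ≤ √(1 - c ^ 2) * ‖w‖ := by
    intro w hw
    refine abs_le_of_sq_le_sq (?_ : w.im ^ 2 ≤ (√(1 - c ^ 2) * ‖w‖) ^ 2) (by positivity)
    rw [mul_pow, Real.sq_sqrt (by nlinarith)]
    have e : ‖w‖ ^ 2 = w.re ^ 2 + w.im ^ 2 := by
      rw [Complex.sq_norm, Complex.normSq_apply]; ring
    have : (c * ‖w‖) ^ 2 ≤ w.re ^ 2 := pow_le_pow_left₀ (by positivity) hw.le 2
    nlinarith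
  have h2 := mul_le_mul (him u hu) (him v hv) (abs_nonneg _) (by positivity)
  rw [← abs_mul, mul_mul_mul_comm, Real.mul_self_sqrt (by nlinarith)] at h2
  have h3 := (le_abs_self _).trans h2
  rw [Complex.mul_re]
  nlinarith

theorem ConeBound.exists_norm_exp_mul_le {c ε α β C : ℝ} {f : ℂ → ℂ}
    (h : ConeBound c ε α β C f) (hC : 0 < C) (hε : 0 < ε) {η : ℝ} (hη : 0 < η) :
    ∃ A : ℝ, 0 < A ∧ ∀ z : ℂ, ‖Complex.exp z * f z‖ ≤ A * Real.exp ((1 + η) * ‖z‖) := by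
  obtain ⟨A, hA, hA'⟩ := h.exists_norm_le_exp hC hη
  refine ⟨max A C, lt_max_of_lt_left hA, fun z => ?_⟩
  rcases le_total z.re (c * ‖z‖) with h1 | h1
  · refine (h.expBound z h1).trans ?_
    gcongr
    · exact le_max_right _ _
    · linarith
  · rw [norm_mul, Complex.norm_exp]
    calc Real.exp z.re * ‖f z‖ ≤ Real.exp ‖z‖ * (A * Real.exp (η * ‖z‖)) := by
          gcongr
          · exact Complex.re_le_norm z
          · exact hA' z h1
      _ = A * Real.exp ((1 + η) * ‖z‖) := by
          rw [mul_left_comm, ← Real.exp_add]; ring_nf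
      _ ≤ _ := by
          gcongr
          exact le_max_left _ _

/-- The exponential bound for the Hadamard product outside a cone. -/
theorem ConeBound.exists_norm_exp_mul_poissonHadamard_le {c ε α₁ β₁ α₂ β₂ C c₁ : ℝ}
    {f g : ℂ → ℂ} (hf : ConeBound c ε α₁ β₁ C f) (hg : ConeBound c ε α₂ β₂ C g) (hC : 0 < C)
    (hc : 0 ≤ c) (hc1 : c ≤ 1) (hε : 0 < ε) (hε1 : ε ≤ 1) (hc₁ : c₁ ≤ 2 * c ^ 2 - 1) :
    ∃ D : ℝ, 0 < D ∧ ∀ z : ℂ, z.re ≤ c₁ * ‖z‖ →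
      ‖Complex.exp z * poissonHadamard f g z‖ ≤ D * Real.exp ((1 - ε / 4) * ‖z‖) := by
  -- With `η = ε/2`, one good and one arbitrary factor give `(1 - ε) + (1 + ε/2) = 2 - ε/2`.
  obtain ⟨A, hA, hA'⟩ := hf.exists_norm_exp_mul_le hC hε (η := ε / 2) (by positivity)
  obtain ⟨B, hB, hB'⟩ := hg.exists_norm_exp_mul_le hC hε (η := ε / 2) (by positivity)
  set M := (A + C) * (B + C) with hM
  have hM0 : 0 < M := by positivity
  have hdG : Differentiable ℂ fun w => Complex.exp w * g w :=
    Complex.differentiable_exp.mul hg.entire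
  set I := ∫ t in Set.Ioi (0 : ℝ), Real.exp (-(ε / 4) * t) with hI
  have hIint : IntegrableOn (fun t : ℝ => Real.exp (-(ε / 4) * t)) (Set.Ioi 0) :=
    integrableOn_exp_mul_Ioi (by linarith) 0
  have hI0 : 0 ≤ I := integral_nonneg fun t => (Real.exp_pos _).le
  refine ⟨M * I + 1, by positivity, fun z hz => ?_⟩
  -- The circle integral multiplies Taylor coefficients, hence the squared factorial; the Laplace
  -- transform restores one `n!`.
  set k : ℕ → ℂ := fun n => poissonCoeff f n * poissonCoeff g n / ((n ! : ℂ) * (n ! : ℂ)) with hk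
  have hprod : ∀ u v : ℂ, ‖u‖ = ‖v‖ → (u * v).re ≤ c₁ * (‖u‖ * ‖v‖) →
      ‖(Complex.exp u * f u) * (Complex.exp v * g v)‖ ≤ M * Real.exp ((2 - ε / 2) * ‖u‖) := by
    intro u v huv h
    rw [norm_mul]
    have e : Real.exp ((2 - ε / 2) * ‖u‖) =
        Real.exp ((1 - ε) * ‖u‖) * Real.exp ((1 + ε / 2) * ‖u‖) := by
      rw [← Real.exp_add]; ring_nf
    rw [e]
    by_cases hu : c * ‖u‖ < u.re
    · by_cases hv : c * ‖v‖ < v.re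
      · have h1 := re_mul_gt_of_cone hc hc1 hu hv
        have h2 := mul_le_mul_of_nonneg_right hc₁ (mul_nonneg (norm_nonneg u) (norm_nonneg v))
        linarith
      · have h1 := hg.expBound v (not_lt.mp hv)
        have h2 := hA' u
        rw [← huv] at h1
        calc _ ≤ A * Real.exp ((1 + ε / 2) * ‖u‖) * (C * Real.exp ((1 - ε) * ‖u‖)) := by gcongr
          _ = (A * C) * (Real.exp ((1 - ε) * ‖u‖) * Real.exp ((1 + ε / 2) * ‖u‖)) := by ring
          _ ≤ _ := by
            gcongr
            nlinarith
    · have h1 := hf.expBound u (not_lt.mp hu)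
      have h2 := hB' v
      rw [← huv] at h2
      calc _ ≤ C * Real.exp ((1 - ε) * ‖u‖) * (B * Real.exp ((1 + ε / 2) * ‖u‖)) := by gcongr
        _ = (C * B) * (Real.exp ((1 - ε) * ‖u‖) * Real.exp ((1 + ε / 2) * ‖u‖)) := by ring
        _ ≤ _ := by
          gcongr
          nlinarith
  have hkernel : ∀ w : ℂ, ∃ S : ℂ, HasSum (fun n => k n * w ^ n) S ∧
      (w.re ≤ c₁ * ‖w‖ → ‖S‖ ≤ M * Real.exp ((2 - ε / 2) * √‖w‖)) := by
    intro w
    obtain ⟨x, hx⟩ := IsAlgClosed.exists_pow_nat_eq w (n := 2) two_pos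
    have hxn : ‖x‖ = √‖w‖ := by rw [← hx, norm_pow, Real.sqrt_sq (norm_nonneg x)]
    have h1 := hasSum_integral_circle (hasSum_poissonCoeff hf.entire) hdG x
    have hpi : (2 * Real.pi : ℂ) ≠ 0 := by
      simp [Real.pi_ne_zero]
    refine ⟨_, (h1.mul_left (2 * Real.pi : ℂ)⁻¹).of_eq fun n => ?_, fun hw => ?_⟩
    · have hn : (n ! : ℂ) ≠ 0 := by exact_mod_cast n.factorial_ne_zero
      change (2 * Real.pi : ℂ)⁻¹ * (_ * (2 * Real.pi * (poissonCoeff g n / _ * _))) = _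
      rw [hk, ← hx]
      field_simp
      ring
    · have h2 := intervalIntegral.norm_integral_le_of_norm_le_const (a := 0) (b := 2 * Real.pi)
        (C := M * Real.exp ((2 - ε / 2) * √‖w‖))
        (f := fun θ : ℝ => Complex.exp (x * Complex.exp (-(θ * Complex.I))) *
          f (x * Complex.exp (-(θ * Complex.I))) * (Complex.exp (x * Complex.exp (θ * Complex.I)) *
          g (x * Complex.exp (θ * Complex.I)))) (fun θ _ => by
            have e1 : ‖x * Complex.exp (-(θ * Complex.I))‖ = √‖w‖ := by
              rw [norm_mul, ← neg_mul, ← Complex.ofReal_neg, Complex.norm_exp_ofReal_mul_I,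
                mul_one, hxn]
            have e2 : ‖x * Complex.exp (θ * Complex.I)‖ = √‖w‖ := by
              rw [norm_mul, Complex.norm_exp_ofReal_mul_I, mul_one, hxn]
            have e3 : x * Complex.exp (-(θ * Complex.I)) * (x * Complex.exp (θ * Complex.I)) = w := by
              rw [mul_mul_mul_comm, ← Complex.exp_add, neg_add_cancel, Complex.exp_zero, ← hx]
              ring
            have := hprod _ _ (e1.trans e2.symm) (by
              rw [e3, e1, e2, Real.mul_self_sqrt (norm_nonneg w)]; exact hw)
            rwa [e1] at this)
      have hpi' : |2 * Real.pi - 0| = 2 * Real.pi := by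
        rw [sub_zero, abs_of_pos (by positivity)]
      rw [hpi'] at h2
      have e4 : ‖(2 * Real.pi : ℂ)⁻¹‖ = (2 * Real.pi)⁻¹ := by
        rw [norm_inv, norm_mul, Complex.norm_real, Real.norm_of_nonneg Real.pi_pos.le]
        simp
      rw [norm_mul, e4, inv_mul_le_iff₀ (by positivity)]
      linarith
  choose S hS hSn using hkernel
  have hsum := (hf.isExpType hC hε).hasSum_poissonHadamard (hg.isExpType hC hε) z
  have e : (fun n : ℕ => poissonCoeff f n * poissonCoeff g n / (n ! : ℂ) * z ^ n) =
      fun n => k n * (n ! : ℂ) * z ^ n := by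
    funext n
    have hn : (n ! : ℂ) ≠ 0 := by exact_mod_cast n.factorial_ne_zero
    rw [hk]
    field_simp
  rw [e] at hsum
  have h1 := hasSum_laplace z hsum.summable (K := fun t => S (z * t)) (fun t _ => hS _)
  rw [hsum.unique h1]
  have hbound : ∀ t : ℝ, 0 < t → ‖(Real.exp (-t) : ℂ) * S (z * t)‖ ≤
      M * Real.exp ((1 - ε / 4) * ‖z‖) * Real.exp (-(ε / 4) * t) := by
    intro t ht
    have hn : ‖z * (t : ℂ)‖ = ‖z‖ * t := by
      rw [norm_mul, Complex.norm_real, Real.norm_of_nonneg ht.le]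
    have h2 := hSn (z * t) (by
      rw [hn, Complex.re_mul_ofReal]
      nlinarith)
    rw [hn, Real.sqrt_mul (norm_nonneg z)] at h2
    -- This bounds the kernel by `e^((1 - ε/4)(‖z‖ + t))`, and `e^(-t)` leaves the integrable
    -- `e^(-εt/4)`.
    have h3 : 2 * (√‖z‖ * √t) ≤ ‖z‖ + t := by
      have := sq_nonneg (√‖z‖ - √t)
      rw [sub_sq, Real.sq_sqrt (norm_nonneg z), Real.sq_sqrt ht.le] at this
      linarith
    rw [norm_mul, Complex.norm_real, Real.norm_of_nonneg (Real.exp_pos _).le]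
    calc Real.exp (-t) * ‖S (z * t)‖
        ≤ Real.exp (-t) * (M * Real.exp ((1 - ε / 4) * (‖z‖ + t))) := by
          refine mul_le_mul_of_nonneg_left (h2.trans ?_) (Real.exp_pos _).le
          refine mul_le_mul_of_nonneg_left (Real.exp_le_exp.mpr ?_) hM0.le
          nlinarith
      _ = _ := by
          rw [mul_left_comm, ← Real.exp_add, mul_assoc M, ← Real.exp_add]
          ring_nf
  have h4 := norm_integral_le_of_norm_le (μ := volume.restrict (Set.Ioi (0 : ℝ)))
    (hIint.const_mul (M * Real.exp ((1 - ε / 4) * ‖z‖)))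
    ((ae_restrict_mem measurableSet_Ioi).mono fun t ht => hbound t ht)
  rw [integral_const_mul] at h4
  have hp := Real.exp_pos ((1 - ε / 4) * ‖z‖)
  calc _ ≤ _ := h4
    _ ≤ _ := by rw [← hI]; nlinarith

end OuterRegion

/-! ### Choice of the cones and conclusion -/

section Main

/-- Two admissible functions satisfy cone estimates with common constants. -/
theorem IsJSAdmissible.exists_common_coneBound {α₁ β₁ α₂ β₂ : ℝ} {f g : ℂ → ℂ}
    (hf : IsJSAdmissible α₁ β₁ f) (hg : IsJSAdmissible α₂ β₂ g) :
    ∃ c₀ : ℝ, 0 < c₀ ∧ c₀ < 1 ∧ ∀ c : ℝ, c₀ ≤ c → c < 1 → ∃ ε C : ℝ, 0 < ε ∧ ε ≤ 1 ∧ 0 < C ∧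
      ConeBound c ε α₁ β₁ C f ∧ ConeBound c ε α₂ β₂ C g := by
  have hcos : ∀ θ : ℝ, 0 < θ → θ < Real.pi / 2 → 0 < Real.cos θ ∧ Real.cos θ < 1 :=
    fun θ h0 h1 => ⟨Real.cos_pos_of_mem_Ioo ⟨by linarith, h1⟩, by
      rw [← Real.cos_zero]
      exact Real.cos_lt_cos_of_nonneg_of_le_pi le_rfl (by linarith [Real.pi_pos]) h0⟩
  obtain ⟨θ₁, h0₁, h1₁, hf⟩ := hf
  obtain ⟨θ₂, h0₂, h1₂, hg⟩ := hg
  obtain ⟨ε₁, C₁, hε₁, hε₁1, hC₁, hf⟩ := hf.exists_coneBound h0₁ h1₁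
  obtain ⟨ε₂, C₂, hε₂, hε₂1, hC₂, hg⟩ := hg.exists_coneBound h0₂ h1₂
  refine ⟨max (Real.cos θ₁) (Real.cos θ₂), lt_max_of_lt_left (hcos _ h0₁ h1₁).1,
    max_lt (hcos _ h0₁ h1₁).2 (hcos _ h0₂ h1₂).2, fun c hc hc1 => ?_⟩
  obtain ⟨ε₃, C₃, hε₃, hε₃1, hC₃, hf⟩ := hf.shrink hC₁ hε₁ hε₁1 ((le_max_left _ _).trans hc) hc1
  obtain ⟨ε₄, C₄, hε₄, hε₄1, hC₄, hg⟩ := hg.shrink hC₂ hε₂ hε₂1 ((le_max_right _ _).trans hc) hc1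
  exact ⟨min ε₃ ε₄, max C₃ C₄, lt_min hε₃ hε₄, (min_le_left _ _).trans hε₃1,
    lt_max_of_lt_left hC₃, hf.mono (min_le_left _ _) (le_max_left _ _) hC₃.le,
    hg.mono (min_le_right _ _) (le_max_right _ _) hC₄.le⟩

end Main

theorem proposition3 (α₁ β₁ α₂ β₂ : ℝ) (f g : ℂ → ℂ)
    (hf : IsJSAdmissible α₁ β₁ f) (hg : IsJSAdmissible α₂ β₂ g) :
    (∀ z : ℂ, Summable fun n : ℕ => poissonCoeff f n * poissonCoeff g n / (n ! : ℂ) * z ^ n) ∧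
    IsJSAdmissible (α₁ + α₂) (β₁ + β₂) (poissonHadamard f g) ∧
    ∃ θ : ℝ, 0 < θ ∧ θ < Real.pi / 2 ∧
      (fun z : ℂ => poissonHadamard f g z - (f z * g z + z * deriv f z * deriv g z))
        =O[cobounded ℂ ⊓ 𝓟 {z : ℂ | |z.arg| ≤ θ}]
          fun z : ℂ => ‖z‖ ^ (α₁ + α₂ - 2) * logPlus ‖z‖ ^ (β₁ + β₂) := by
  obtain ⟨c, hc, hc1, hcone⟩ := hf.exists_common_coneBound hg
  obtain ⟨ε, C, hε, hε1, hC, hfc, hgc⟩ := hcone c le_rfl hc1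
  have hfe := hfc.isExpType hC hε
  have hge := hgc.isExpType hC hε
  -- The first entry makes room for circles of relative radius `δ`, since `c + 2δ = (1 + c)/2`; the
  -- second is the narrowness required by the high-order terms.
  set c₁ := max ((1 + c) / 2) (1 - ε ^ 2 / 8) with hc₁
  have hc₁1 : c₁ < 1 := max_lt (by linarith) (by have := pow_pos hε 2; linarith)
  have hcc₁ : (1 + c) / 2 ≤ c₁ := le_max_left _ _
  have hc₁0 : 0 < c₁ := by linarith
  set δ := (1 - c) / 4 with hδ
  have hδ0 : 0 < δ := by rw [hδ]; linarith
  have hδ1 : δ ≤ 1 / 2 := by rw [hδ]; linarith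
  have hδ2 : c * (1 + δ) ≤ c₁ - δ := by rw [hδ]; nlinarith
  have hε2 : 2 * (1 - c₁) ≤ (ε / 2) ^ 2 := by
    have : 1 - ε ^ 2 / 8 ≤ c₁ := le_max_right _ _
    nlinarith
  obtain ⟨D, hD, hD'⟩ := hfc.exists_hadamardSeries_sub_le hgc hC hc hε hε1 hδ0 hδ1 hδ2 hε2
  -- The outer bound must reach the same `c₁`. It starts from a narrower cone, with its own `ε₂`:
  -- `2c₂² - 1 = c₁ + (1 - c₁)²/8 ≥ c₁`.
  set c₂ := (3 + c₁) / 4 with hc₂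
  obtain ⟨ε₂, C₂, hε₂, hε₂1, hC₂, hfc₂, hgc₂⟩ := hcone c₂ (by rw [hc₂]; linarith)
    (by rw [hc₂]; linarith)
  obtain ⟨E, hE, hE'⟩ := hfc₂.exists_norm_exp_mul_poissonHadamard_le hgc₂ hC₂
    (by rw [hc₂]; linarith) (by rw [hc₂]; linarith) hε₂ hε₂1 (c₁ := c₁)
    (by rw [hc₂]; nlinarith [sq_nonneg (1 - c₁)])
  rw [hfe.poissonHadamard_eq hge] at hE' ⊢
  refine ⟨fun z => (hfe.hasSum_poissonHadamard hge z).summable, ?_,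
    Real.arccos c₁, Real.arccos_pos.mpr hc₁1, Real.arccos_lt_pi_div_two.mpr hc₁0, ?_⟩
  · set p := C * (2 ^ |α₁| * 2 ^ |β₁|) with hp
    set q := C * (2 ^ |α₂| * 2 ^ |β₂|) with hq
    have hp0 : 0 < p := by positivity
    have hq0 : 0 < q := by positivity
    refine isJSAdmissible_of_cone (C := max (D + C * C + p * q / δ ^ 2) E)
      (hfe.differentiable_hadamardSeries hge) hc₁0 hc₁1 (show 0 < ε₂ / 4 by positivity)
      (fun z hz hz1 => ?_) (fun z hz => (hE' z hz).trans ?_)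
    · have hz0 : 0 < ‖z‖ := by linarith
      have hzc : c * ‖z‖ ≤ z.re := by nlinarith
      have hW₁ := growthScale_pos (a := α₁) (b := β₁) hz0
      have hW₂ := growthScale_pos (a := α₂) (b := β₂) hz0
      have hW := growthScale_pos (a := α₁ + α₂) (b := β₁ + β₂) hz0
      have h1 : ‖hadamardSeries f g z - (f z * g z + z * deriv f z * deriv g z)‖ ≤
          D * growthScale (α₁ + α₂) (β₁ + β₂) ‖z‖ := by
        refine (hD' z hz hz1).trans (mul_le_mul_of_nonneg_left ?_ hD.le)
        rw [growthScale_sub_two hz0]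
        exact div_le_self hW.le (one_le_pow₀ hz)
      have h2 : ‖f z * g z‖ ≤ C * C * growthScale (α₁ + α₂) (β₁ + β₂) ‖z‖ := by
        rw [norm_mul, ← growthScale_mul hz0, ← mul_mul_mul_comm]
        exact mul_le_mul (hfc.growth z (by linarith) hzc) (hgc.growth z (by linarith) hzc)
          (norm_nonneg _) (by positivity)
      have h3 : ‖z * deriv f z * deriv g z‖ ≤
          p * q / δ ^ 2 * growthScale (α₁ + α₂) (β₁ + β₂) ‖z‖ := by
        have h4 := hfc.norm_iteratedDeriv_le hC hc hδ0 hδ1 hδ2 1 hz hz1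
        have h5 := hgc.norm_iteratedDeriv_le hC hc hδ0 hδ1 hδ2 1 hz hz1
        simp only [iteratedDeriv_one, Nat.factorial_one, Nat.cast_one, one_mul, pow_one] at h4 h5
        rw [mul_assoc, norm_mul, norm_mul, ← growthScale_mul hz0]
        calc ‖z‖ * (‖deriv f z‖ * ‖deriv g z‖)
            ≤ ‖z‖ * (p * growthScale α₁ β₁ ‖z‖ / (δ * ‖z‖) *
                (q * growthScale α₂ β₂ ‖z‖ / (δ * ‖z‖))) := by gcongr
          _ = p * q / δ ^ 2 * (growthScale α₁ β₁ ‖z‖ * growthScale α₂ β₂ ‖z‖) / ‖z‖ := by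
              field_simp
          _ ≤ _ := div_le_self (by positivity) hz
      have h6 : ‖hadamardSeries f g z‖ ≤
          (D + C * C + p * q / δ ^ 2) * growthScale (α₁ + α₂) (β₁ + β₂) ‖z‖ := by
        have h7 := norm_add_le (hadamardSeries f g z - (f z * g z + z * deriv f z * deriv g z))
          (f z * g z + z * deriv f z * deriv g z)
        rw [sub_add_cancel] at h7
        have h8 := norm_add_le (f z * g z) (z * deriv f z * deriv g z)
        linarith
      exact h6.trans (mul_le_mul_of_nonneg_right (le_max_left _ _) hW.le)
    · gcongr
      exact le_max_right _ _
  · refine IsBigO.of_bound D ?_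
    have hmem : {z : ℂ | 1 ≤ ‖z‖} ∈ cobounded ℂ :=
      tendsto_norm_cobounded_atTop.eventually_ge_atTop 1
    filter_upwards [mem_inf_of_left hmem, mem_inf_of_right (mem_principal_self _)] with z hz hz1
    replace hz : 1 ≤ ‖z‖ := hz
    replace hz1 : |z.arg| ≤ Real.arccos c₁ := hz1
    have hz0 : 0 < ‖z‖ := by linarith
    rw [abs_arg_le_iff (norm_pos_iff.mp hz0) (Real.arccos_nonneg _)
      (Real.arccos_le_pi _), Real.cos_arccos (by linarith) hc₁1.le] at hz1
    change _ ≤ D * ‖growthScale (α₁ + α₂ - 2) (β₁ + β₂) ‖z‖‖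
    rw [Real.norm_of_nonneg (growthScale_pos hz0).le]
    exact hD' z hz hz1
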